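/- Let $T$ be a locally compact metric space, $C(T)$ the space of continuous functions $T\to\mathbb R$ with the Borel $\sigma$-algebra of locally uniform convergence, and $C_0(T)=\{f\in C(T): f\ge 0,\ f\ne 0\}$. Let $X=(X_s)_{s\in T}$ be a non-negative process with continuous paths that is max-infinitely divisible (for every $n\ge1$ it has the law of the pointwise maximum of $n$ i.i.d. processes) and has vertex $0$, i.e. $\sup\{x\in\mathbb R:\mathbb P(X_s>x)=1\}=0$ for all $s\in T$. Let $\mu$ be its exponent measure on $C_0(T)$: $\mu(\{f:\sup_K f>\varepsilon\})<\infty$ for all compact $K\subset T$ and all $\varepsilon>0$, and $X\sim\max_{f\in N}f$ for a Poisson random measure (PRM) $N=\sum_i\delta_{f_i}$ (at most countably many atoms) on $C_0(T)$ with intensity $\mu$, where maxima of functions are pointwise and $\max_\emptyset=0$. Let $t_1,\dots,t_d\in T$ and put $$J_0=\{j:\mathbb P(X_{t_j}=0)>0\},\qquad \mu_j=\mu\big(\cdot\cap\{f: f(t_j)>0,\ f(t_k)=0\ \text{for all } k<j,\ k\in J_0\}\big)\ (j\in J_0),\qquad \tilde\mu=\mu\big(\cdot\cap\{f: f(t_j)=0\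 \text{for all } j\in J_0\}\big).$$ Assume that for all $s\in T$ and $c>0$ one can simulate a finite PRM with intensity $\mathbf 1_{\{f(s)\ge c\}}\,d\mu(f)$ (by a procedure that takes a random seed and is jointly measurable in the seed and in $c$), and that one can simulate the finite PRMs with intensities $\mu_j$, $j\in J_0$, that step 1 below calls for. All calls use fresh independent seeds, and each call counts as one step. Consider the following algorithm; the $c^{(1)},\dots,c^{(d)}>0$ are arbitrary constants. 1. For each $j\in J_0$ simulate a finite PRM $N_j$ with intensity $\mu_j$ and set $\hat X_j=\max_{f\in N_j}f$. Set $\tilde X=0$ (as a function on $T$). 2. For $i=1,\dots,d$ with $i\notin J_0$ do: - (a) If $\tilde X_{t_i}=0$: set $c_u=\infty$, $c_l=c^{(i)}$ and repeat the following until $\tilde N^+\neq\emptyset$: simulate a finite PRM $\tilde N^+$ with intensity $\mathbf 1_{\{c_u>f(t_i)\ge c_l\}}\,d\tilde\mu(f)$ (by simulating with intensity $\mathbf 1_{\{f(t_i)\ge c_l\}}\,d\mu(f)$ and ignoring the atoms that violate the other constraints); discard every atom $f$ with $f(t_k)\ge\tilde X_{t_k}$ for some $k<i$, $k\notin J_0$;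 replace $(c_u,c_l)$ by $(c_l,c_l/2)$. - (b) If $\tilde X_{t_i}\ne0$: simulate, in the same way, a finite PRM $\tilde N^+$ with intensity $\mathbf 1_{\{f(t_i)\ge\tilde X_{t_i}\}}\,d\tilde\mu(f)$ and discard every atom $f$ with $f(t_k)\ge\tilde X_{t_k}$ for some $k<i$, $k\notin J_0$. - (c) Keep in $\tilde N^+$ only the atoms that are extremal at $t_i$, i.e. that maximise $f(t_i)$ over $f\in\tilde N^+$, and replace $\tilde X$ by $\max\{\max_{f\in\tilde N^+}f,\ \tilde X\}$. 3. Return $\hat X=\max\{\max_{j\in J_0}\hat X_j,\ \tilde X\}$. Then every $\mu_j$, $j\in J_0$, is a finite measure, the algorithm stops almost surely after finitely many steps, and its output satisfies $(\hat X_{t_1},\dots,\hat X_{t_d})\sim(X_{t_1},\dots,X_{t_d})$. -/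

import Mathlib

open MeasureTheory ProbabilityTheory
open scoped ENNReal

namespace MaxId

/-- The Borel σ-algebra of the topology of uniform convergence on compact sets. -/
instance instMeasurableSpaceContinuousMap {T : Type*} [TopologicalSpace T] :
    MeasurableSpace C(T, ℝ) := borel _

instance instBorelSpaceContinuousMap {T : Type*} [TopologicalSpace T] :
    BorelSpace C(T, ℝ) := ⟨rfl⟩

/-- `C₀(T)`: the continuous functions `f ≥ 0` on `T` with `f ≠ 0`. -/
abbrev C0 (T : Type*) [TopologicalSpace T] : Type _ :=
  {f : C(T, ℝ) // (∀ s, 0 ≤ f s) ∧ f ≠ 0}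

section PointProcess

variable {E : Type*} [MeasurableSpace E]

/-- A point measure: the sum of at most countably many Dirac measures. -/
def IsPointMeasure (ν : Measure E) : Prop :=
  ∃ (I : Set ℕ) (f : ℕ → E), ν = Measure.sum (fun i : I => Measure.dirac (f i))

/-- A finite point measure: the sum of finitely many Dirac measures. -/
def IsFinitePointMeasure (ν : Measure E) : Prop :=
  ∃ (n : ℕ) (f : Fin n → E), ν = ∑ i, Measure.dirac (f i)

/-- The Poisson distribution with mean `a ∈ [0, ∞]` on `[0, ∞]`; for `a = ∞` it is the point
mass at `∞`. -/
noncomputable def poissonLaw (a : ℝ≥0∞) : Measure ℝ≥0∞ :=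
  open Classical in
  if a = ∞ then Measure.dirac ∞ else (poissonMeasure a.toNNReal).map (fun k : ℕ => (k : ℝ≥0∞))

/-- `N` is, under the probability measure `P`, a Poisson random measure with intensity `ν`. -/
structure IsPoissonRandomMeasure {Ω : Type*} [MeasurableSpace Ω] (P : Measure Ω)
    (ν : Measure E) (N : Ω → Measure E) : Prop where
  measurable : Measurable N
  pointMeasure : ∀ᵐ ω ∂P, IsPointMeasure (N ω)
  poisson : ∀ A, MeasurableSet A → HasLaw (fun ω => N ω A) (poissonLaw (ν A)) P
  indep : ∀ (n : ℕ) (A : Fin n → Set E), (∀ i, MeasurableSet (A i)) →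
    Pairwise (fun i j => Disjoint (A i) (A j)) → iIndepFun (fun i ω => N ω (A i)) P

/-- `sim` is a simulation procedure for the finite Poisson random measure with intensity `ν`:
started from a random seed with law `ρ`, it always returns a finite point measure, and its output
is a Poisson random measure with intensity `ν`. -/
def SimulatesFinitePRM {S : Type*} [MeasurableSpace S] (ρ : Measure S)
    (ν : Measure E) (sim : S → Measure E) : Prop :=
  IsPoissonRandomMeasure ρ ν sim ∧ ∀ u, IsFinitePointMeasure (sim u)

end PointProcess

section MaxIdProcess

variable {T : Type*} {Ω : Type*} [MeasurableSpace Ω]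

/-- The process `X` is max-infinitely divisible: for every `n ≥ 1` it has the law of the pointwise
maximum of `n` independent processes with a common law `κ` on `ℝ^T`. -/
def IsMaxId (P : Measure Ω) (X : T → Ω → ℝ) : Prop :=
  ∀ n : ℕ, 1 ≤ n → ∃ κ : ProbabilityMeasure (T → ℝ),
    P.map (fun ω s => X s ω) =
      (Measure.pi (fun _ : Fin n => (κ : Measure (T → ℝ)))).map (fun x s => ⨆ i, x i s)

/-- The vertex `s ↦ sup {x ∈ ℝ | P(X_s > x) = 1}` of `X`. -/
noncomputable def vertex (P : Measure Ω) (X : T → Ω → ℝ) (s : T) : EReal :=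
  ⨆ (x : ℝ) (_ : P {ω | x < X s ω} = 1), (x : EReal)

end MaxIdProcess

section Exponent

variable {T : Type*} [TopologicalSpace T]

/-- The finiteness condition on exponent measures: for compact `K` and `ε > 0`, the functions `f`
with `sup_K f > ε` have finite mass. -/
def IsExponentMeasure (μ : Measure (C0 T)) : Prop :=
  ∀ K : Set T, IsCompact K → ∀ ε : ℝ, 0 < ε → μ {f : C0 T | ∃ k ∈ K, ε < f.1 k} < ∞

/-- The pointwise maximum `max_{f ∈ N} f` of the atoms of a point measure `N`; it is `0` if there
are no atoms (the supremum of the empty set of reals is `0` in Mathlib). -/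
noncomputable def maxAtoms (N : Measure (C0 T)) (s : T) : ℝ :=
  ⨆ f : {f : C0 T // 1 ≤ N {f}}, f.1.1 s

/-- The atoms of `N` that are extremal at `s`, i.e. that maximise `f(s)` among the atoms. -/
noncomputable def extremalAt (s : T) (N : Measure (C0 T)) : Measure (C0 T) :=
  N.restrict {f : C0 T | f.1 s = maxAtoms N s}

end Exponent

section Algorithm

variable {T : Type*} [TopologicalSpace T] {d : ℕ}

/-- The set of indices `j` with `P(X_{t_j} = 0) > 0`. -/
def zeroLocations {Ω : Type*} [MeasurableSpace Ω] (P : Measure Ω) (X : T → Ω → ℝ)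
    (t : Fin d → T) : Set (Fin d) :=
  {j | 0 < P {ω | X (t j) ω = 0}}

/-- The measure `μ_j`: the restriction of `μ` to the functions with `f(t_j) > 0` and `f(t_k) = 0`
for all `k < j` in `J₀`. -/
noncomputable def muPart (μ : Measure (C0 T)) (t : Fin d → T) (J₀ : Set (Fin d)) (j : Fin d) :
    Measure (C0 T) :=
  μ.restrict {f : C0 T | 0 < f.1 (t j) ∧ ∀ k < j, k ∈ J₀ → f.1 (t k) = 0}

/-- The set on which the residual part `μ̃` of `μ` lives: `f(t_j) = 0` for all `j ∈ J₀`. -/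
def residualSet (t : Fin d → T) (J₀ : Set (Fin d)) : Set (C0 T) :=
  {f | ∀ j ∈ J₀, f.1 (t j) = 0}

/-- The functions that are not discarded at location `i`, given the current path `x`. -/
def admissible (t : Fin d → T) (J₀ : Set (Fin d)) (i : Fin d) (x : T → ℝ) : Set (C0 T) :=
  {f | ∀ k < i, k ∉ J₀ → f.1 (t k) < x (t k)}

/-- The lower level `c_l` in pass number `n = 0, 1, 2, …` of the while-loop: `c, c/2, c/4, …`. -/
noncomputable def lowerLevel (c : ℝ) (n : ℕ) : ℝ := c / 2 ^ n

/-- The upper level `c_u` in pass number `n` of the while-loop: `∞`, then the previous `c_l`. -/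
noncomputable def upperLevel (c : ℝ) : ℕ → EReal
  | 0 => ⊤
  | n + 1 => (lowerLevel c n : EReal)

/-- The state of the main loop: `pos` is the location in progress (the loop is over when
`pos = d`), `iter` counts the passes of the while-loop completed at this location, and `path` is
the current function `X̃`. -/
structure State (T : Type*) where
  pos : ℕ
  iter : ℕ
  path : T → ℝ

/-- The start of the main loop: the first location, with `X̃ = 0`. -/
def State.init (T : Type*) : State T := ⟨0, 0, fun _ => 0⟩

/-- Finish the current location with the retained atoms `N`: those extremal at the location `s`
are merged into the path. -/
noncomputable def State.finish (σ : State T) (s : T) (N : Measure (C0 T)) : State T :=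
  ⟨σ.pos + 1, 0, fun r => max (maxAtoms (extremalAt s N) r) (σ.path r)⟩

variable {S : Type*}

/-- One step of the main loop. `sim s c u` is the simulated finite Poisson random measure with
intensity `1{f(s) ≥ c} dμ(f)`, produced from the seed `u`; the seeds `u i n` are used at location
`i` in pass `n`. Simulation from `1{c_u > f(t_i) ≥ c_l} dμ̃(f)` or `1{f(t_i) ≥ X̃_{t_i}} dμ̃(f)`
means to simulate from `1{f(t_i) ≥ c_l} dμ(f)` or `1{f(t_i) ≥ X̃_{t_i}} dμ(f)` and to ignore the
atoms outside the required set. -/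
noncomputable def step (sim : T → ℝ → S → Measure (C0 T)) (t : Fin d → T) (J₀ : Set (Fin d))
    (c : Fin d → ℝ) (u : Fin d → ℕ → S) (σ : State T) : State T :=
  open Classical in
  if h : σ.pos < d then
    let i : Fin d := ⟨σ.pos, h⟩
    if i ∈ J₀ then
      ⟨σ.pos + 1, 0, σ.path⟩
    else if σ.path (t i) = 0 then
      let N := (sim (t i) (lowerLevel (c i) σ.iter) (u i σ.iter)).restrict
        (residualSet t J₀ ∩ {f | (f.1 (t i) : EReal) < upperLevel (c i) σ.iter}
          ∩ admissible t J₀ i σ.path)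
      if N = 0 then
        ⟨σ.pos, σ.iter + 1, σ.path⟩
      else
        σ.finish (t i) N
    else
      let N := (sim (t i) (σ.path (t i)) (u i σ.iter)).restrict
        (residualSet t J₀ ∩ admissible t J₀ i σ.path)
      σ.finish (t i) N
  else σ

/-- The state of the main loop after `m` steps. -/
noncomputable def run (sim : T → ℝ → S → Measure (C0 T)) (t : Fin d → T) (J₀ : Set (Fin d))
    (c : Fin d → ℝ) (u : Fin d → ℕ → S) (m : ℕ) : State T :=
  (step sim t J₀ c u)^[m] (State.init T)

/-- The algorithm stops after finitely many steps. -/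
def Terminates (sim : T → ℝ → S → Measure (C0 T)) (t : Fin d → T) (J₀ : Set (Fin d))
    (c : Fin d → ℝ) (u : Fin d → ℕ → S) : Prop :=
  ∃ m, (run sim t J₀ c u m).pos = d

/-- The path `X̃` at the end of the main loop (by convention `0` if the loop never ends). -/
noncomputable def finalPath (sim : T → ℝ → S → Measure (C0 T)) (t : Fin d → T) (J₀ : Set (Fin d))
    (c : Fin d → ℝ) (u : Fin d → ℕ → S) : T → ℝ :=
  open Classical in
  if h : Terminates sim t J₀ c u then (run sim t J₀ c u (Nat.find h)).path else fun _ => 0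

/-- The output `X̂ = max {max_{j ∈ J₀} X̂_j, X̃}`. Here `simJ j u` is the simulated finite Poisson
random measure with intensity `μ_j`, produced from the seed `u`, and `X̂_j` is the pointwise maximum
of its atoms; the seed `u j 0` is not used by the main loop when `j ∈ J₀`. -/
noncomputable def output (sim : T → ℝ → S → Measure (C0 T)) (simJ : Fin d → S → Measure (C0 T))
    (t : Fin d → T) (J₀ : Set (Fin d)) (c : Fin d → ℝ) (u : Fin d → ℕ → S) (s : T) : ℝ :=
  max (⨆ j : J₀, maxAtoms (simJ j (u j 0)) s) (finalPath sim t J₀ c u s)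

end Algorithm

end MaxId

/-!
The distribution function of `(X_{t_1}, …, X_{t_d})` at `y ≥ 0` is `exp (-μ (exceed t y))`, the
probability that the Poisson random measure has no atom exceeding `y` at some location
(`IsPoissonRandomMeasure.measure_maxAtoms_le`). In particular `J₀` consists of the `j` with
`μ {f | 0 < f (t j)} < ∞`, so all `μ_j` are finite. It has to be shown that the algorithm stops and
that its output has the same distribution function.

*Exactness of one step* (`SimulatesFinitePRM.lintegral_extremal`). If only the atoms of a Poisson
random measure that are extremal at `s` are revealed, then the other atoms, which are lower at `s`,
still form a Poisson random measure with the intensity restricted to the functions below the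
revealed height. Split a set of functions into the part in `B` and the part outside `B`. The
maxima at `s` over the two parts are independent, and integrating out the first one leaves a
quantity that does not depend on the second one. This gives the form of the statement that is
needed: the expectation of
`1{no revealed atom in B} * exp (-ν (B ∩ {f | f s < revealed height}))` is `exp (-ν B)`.

*A martingale* (`potential`). The state of the main loop determines which functions can still be
atoms of the unexplored part of the residual random measure: those in `remaining`, and in `window`
while the while-loop is running. Let the potential be `0` if the current path exceeds `y`
somewhere, and otherwise `exp (-μ (·))` of the part of this set that lies in `exceed t y`. By the
first point a step with a fresh seed preserves its expectation (`lintegral_potential_step`). The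
seed that is about to be read is independent of the current state, since a run that is about to
read the seed `(i, n)` does not depend on it (`run_congr_of_at`, `lintegral_fresh`), so the
expectation is preserved along the run (`lintegral_potential_run`). It equals
`exp (-μ (residualSet ∩ exceed t y))` at the start. At the end no remaining function exceeds `y`,
so it is the indicator that the final path stays below `y`. The seeds of the locations in `J₀` are
not read by the main loop and contribute the independent factors `exp (-μ_j (exceed t y))`. The
product of all factors is `exp (-μ (exceed t y))` by `measure_eq_sum_muPart_add`
(`measure_output_le`).

*Termination* (`ae_not_forall_at`). For `i ∉ J₀` the set `{f | 0 < f (t i)}` has infinite mass. The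
functions excluded before location `i` have finite mass, because the path is positive at the
earlier locations outside `J₀` (`posBefore_run`, `measure_remaining_eq_top`). So the probability
that all passes down to the lower level `ℓ` are unsuccessful tends to `0` as `ℓ → 0`.
-/

namespace MaxId

open Set Filter Topology

/-! ### The function `a ↦ exp (-a)` on `[0, ∞]` -/

/-- The function `a ↦ exp (-a)` on `[0, ∞]`, with `exp (-∞) = 0`: the probability that a Poisson
random measure puts no point into a set of intensity `a`. -/
noncomputable def expNeg (a : ℝ≥0∞) : ℝ≥0∞ := EReal.exp (-(a : EReal))

@[simp] lemma expNeg_zero : expNeg 0 = 1 := by simp [expNeg]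

@[simp] lemma expNeg_top : expNeg ∞ = 0 := by simp [expNeg]

lemma expNeg_add (a b : ℝ≥0∞) : expNeg (a + b) = expNeg a * expNeg b := by
  simp only [expNeg, EReal.exp_neg, EReal.coe_ennreal_add, EReal.exp_add]
  refine ENNReal.mul_inv (Or.inl ?_) (Or.inr ?_)
  · simp [EReal.exp_eq_zero_iff]
  · simp [EReal.exp_eq_zero_iff]

lemma expNeg_le_one (a : ℝ≥0∞) : expNeg a ≤ 1 := by
  simpa [expNeg] using EReal.coe_ennreal_nonneg a

lemma expNeg_pos_iff {a : ℝ≥0∞} : 0 < expNeg a ↔ a < ∞ := by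
  rw [expNeg, EReal.zero_lt_exp_iff, bot_lt_iff_ne_bot, lt_top_iff_ne_top, not_iff_not]
  simp [EReal.neg_eq_bot_iff]

lemma expNeg_antitone : Antitone expNeg := fun a b h =>
  EReal.exp_monotone (EReal.neg_le_neg_iff.2 (by exact_mod_cast h))

lemma measurable_expNeg : Measurable expNeg := expNeg_antitone.measurable

lemma tendsto_expNeg_top {a : ℕ → ℝ≥0∞} (h : Tendsto a atTop (𝓝 ∞)) :
    Tendsto (fun n => expNeg (a n)) atTop (𝓝 0) := by
  have h0 : Tendsto (fun n => -((a n : ℝ≥0∞) : EReal)) atTop (𝓝 ⊥) := by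
    have := (continuous_coe_ennreal_ereal.tendsto ∞).comp h
    simpa [Function.comp_def] using (continuous_neg.tendsto _).comp this
  simpa [expNeg, Function.comp_def] using (ENNReal.continuous_exp.tendsto ⊥).comp h0

lemma poissonLaw_singleton_zero (a : ℝ≥0∞) : poissonLaw a {0} = expNeg a := by
  rw [poissonLaw]
  split_ifs with h
  · subst h; simp
  · rw [Measure.map_apply (by fun_prop) (measurableSet_singleton 0)]
    have : (fun k : ℕ => (k : ℝ≥0∞)) ⁻¹' {0} = {0} := by ext; simp
    rw [this, poissonMeasure_singleton]
    lift a to NNReal using h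
    have : ((a : ℝ≥0∞) : EReal) = ((a : ℝ) : EReal) := rfl
    rw [expNeg, this, ← EReal.coe_neg, EReal.exp_coe]
    simp

lemma IsPoissonRandomMeasure.measure_eq_zero {E : Type*} [MeasurableSpace E] {Ω : Type*}
    [MeasurableSpace Ω] {P : Measure Ω} {ν : Measure E} {N : Ω → Measure E}
    (hN : IsPoissonRandomMeasure P ν N) {A : Set E} (hA : MeasurableSet A) :
    P {ω | N ω A = 0} = expNeg (ν A) := by
  rw [← poissonLaw_singleton_zero]
  exact (hN.poisson A hA).measure_eq (p := fun x => x = 0) (measurableSet_singleton 0)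

/-! ### Point measures -/

section PointMeasures

variable {E : Type*} [MeasurableSpace E]

/-- The atoms of a point measure: the points of mass at least `1`. -/
def atoms (ν : Measure E) : Set E := {f | 1 ≤ ν {f}}

/-- A finite measure with finitely many atoms which charges a measurable set only if the set
contains an atom. Finite point measures have this property, and unlike the representation as a sum
of Dirac measures it restricts to subsets without relabelling. -/
structure FinitelyAtomic (ν : Measure E) : Prop where
  isFiniteMeasure : IsFiniteMeasure ν
  finite : (atoms ν).Finite
  null_iff : ∀ ⦃B : Set E⦄, MeasurableSet B → (ν B = 0 ↔ ∀ f ∈ atoms ν, f ∉ B)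

lemma FinitelyAtomic.eq_zero_iff {ν : Measure E} (h : FinitelyAtomic ν) :
    ν = 0 ↔ atoms ν = ∅ := by
  rw [← Measure.measure_univ_eq_zero, h.null_iff MeasurableSet.univ, eq_empty_iff_forall_notMem]
  simp

lemma finitelyAtomic_zero : FinitelyAtomic (0 : Measure E) := by
  have h : atoms (0 : Measure E) = ∅ := by ext; simp [atoms]
  exact ⟨inferInstance, by simp [h], by simp [h]⟩

variable [MeasurableSingletonClass E]

lemma atoms_restrict (ν : Measure E) (G : Set E) : atoms (ν.restrict G) = atoms ν ∩ G := by
  ext f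
  simp only [atoms, mem_ofPred_eq, mem_inter_iff]
  rw [Measure.restrict_apply (measurableSet_singleton f)]
  by_cases hf : f ∈ G
  · rw [inter_eq_left.2 (singleton_subset_iff.2 hf)]; simp [hf]
  · rw [singleton_inter_eq_empty.2 hf]; simp [hf]

lemma IsPointMeasure.measure_eq_zero_iff {ν : Measure E} (h : IsPointMeasure ν) {B : Set E}
    (hB : MeasurableSet B) : ν B = 0 ↔ ∀ f ∈ atoms ν, f ∉ B := by
  constructor
  · intro h0 f hf hfB
    have : ν {f} ≤ ν B := measure_mono (singleton_subset_iff.2 hfB)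
    rw [h0] at this
    exact absurd (hf.trans this) (by simp)
  · obtain ⟨I, f, rfl⟩ := h
    intro h0
    rw [Measure.sum_apply _ hB, ENNReal.tsum_eq_zero]
    intro i
    rw [Measure.dirac_apply' _ hB, indicator_of_notMem]
    refine h0 _ ?_
    rw [atoms, mem_ofPred_eq, Measure.sum_apply _ (measurableSet_singleton _)]
    refine le_trans ?_ (ENNReal.le_tsum i)
    simp

/-- A measure has only finitely many atoms in a set of finite mass. -/
lemma finite_atoms_inter {ν : Measure E} {B : Set E} (hB : ν B < ∞) :
    (atoms ν ∩ B).Finite := by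
  rw [← atoms_restrict]
  refine Measure.finite_const_le_meas_of_disjoint_iUnion (ν.restrict B) one_pos
    (fun f => measurableSet_singleton f) ?_ ?_
  · intro f g hfg; simpa using hfg
  · rw [iUnion_of_singleton]; simpa using hB.ne

lemma IsFinitePointMeasure.finitelyAtomic {ν : Measure E} (h : IsFinitePointMeasure ν) :
    FinitelyAtomic ν := by
  obtain ⟨n, f, rfl⟩ := h
  refine ⟨inferInstance, ?_, fun B hB => ⟨fun h0 g hg hgB => ?_, fun h0 => ?_⟩⟩
  · refine (finite_range f).subset fun x hx => ?_
    by_contra hc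
    have : ∀ i, f i ≠ x := fun i hi => hc ⟨i, hi⟩
    simp [atoms, this] at hx
  · have := measure_mono (μ := ∑ i, Measure.dirac (f i)) (singleton_subset_iff.2 hgB)
    rw [h0] at this
    exact absurd (le_trans hg this) (by simp)
  · rw [Measure.finsetSum_apply]
    refine Finset.sum_eq_zero fun i _ => ?_
    rw [Measure.dirac_apply' _ hB, indicator_of_notMem]
    refine h0 _ ?_
    rw [atoms, mem_ofPred_eq, Measure.finsetSum_apply]
    refine le_trans ?_ (Finset.single_le_sum (fun _ _ => zero_le) (Finset.mem_univ i))
    simp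

lemma FinitelyAtomic.restrict {ν : Measure E} (h : FinitelyAtomic ν) (G : Set E)
    (hG : MeasurableSet G) : FinitelyAtomic (ν.restrict G) := by
  have := h.isFiniteMeasure
  refine ⟨inferInstance, ?_, fun B hB => ?_⟩
  · rw [atoms_restrict]; exact h.finite.inter_of_left _
  · rw [Measure.restrict_apply hB, h.null_iff (hB.inter hG), atoms_restrict]
    exact ⟨fun H f hf hfB => H f hf.1 ⟨hfB, hf.2⟩, fun H f hf hfB => H f ⟨hf, hfB.2⟩ hfB.1⟩

end PointMeasures

/-! ### Maxima over the atoms -/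

section Maxima

variable {T : Type*} [TopologicalSpace T]

lemma measurable_eval (s : T) : Measurable (fun f : C0 T => f.1 s) :=
  ((continuous_eval_const s).comp continuous_subtype_val).measurable

lemma maxAtoms_eq (K : Measure (C0 T)) (s : T) : maxAtoms K s = ⨆ f : atoms K, f.1.1 s := rfl

lemma maxAtoms_nonneg (K : Measure (C0 T)) (s : T) : 0 ≤ maxAtoms K s :=
  Real.iSup_nonneg fun f => f.1.2.1 s

lemma maxAtoms_of_atoms_eq_empty {K : Measure (C0 T)} (h : atoms K = ∅) (s : T) :
    maxAtoms K s = 0 := by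
  rw [maxAtoms_eq, h]; exact Real.iSup_of_isEmpty _

lemma FinitelyAtomic.le_maxAtoms {K : Measure (C0 T)} (hK : FinitelyAtomic K) {f : C0 T}
    (hf : f ∈ atoms K) (s : T) : f.1 s ≤ maxAtoms K s := by
  have := hK.finite.to_subtype
  exact le_ciSup (f := fun f : atoms K => f.1.1 s) (finite_range _).bddAbove ⟨f, hf⟩

lemma FinitelyAtomic.exists_eq_maxAtoms {K : Measure (C0 T)} (hK : FinitelyAtomic K)
    (h : (atoms K).Nonempty) (s : T) : ∃ f ∈ atoms K, f.1 s = maxAtoms K s := by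
  have := hK.finite.to_subtype
  have := h.to_subtype
  obtain ⟨f, hf⟩ := exists_eq_ciSup_of_finite (f := fun f : atoms K => f.1.1 s)
  exact ⟨f, f.2, hf⟩

lemma FinitelyAtomic.maxAtoms_le_iff {K : Measure (C0 T)} (hK : FinitelyAtomic K) {s : T} {r : ℝ}
    (hr : 0 ≤ r) : maxAtoms K s ≤ r ↔ ∀ f ∈ atoms K, f.1 s ≤ r :=
  ⟨fun h _ hf => (hK.le_maxAtoms hf s).trans h,
    fun h => Real.iSup_le (fun f => h f.1 f.2) hr⟩

lemma FinitelyAtomic.maxAtoms_lt_iff {K : Measure (C0 T)} (hK : FinitelyAtomic K) {s : T} {r : ℝ}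
    (hr : 0 < r) : maxAtoms K s < r ↔ ∀ f ∈ atoms K, f.1 s < r := by
  refine ⟨fun h _ hf => (hK.le_maxAtoms hf s).trans_lt h, fun h => ?_⟩
  rcases (atoms K).eq_empty_or_nonempty with h0 | h0
  · rwa [maxAtoms_of_atoms_eq_empty h0]
  · obtain ⟨f, hf, hfs⟩ := hK.exists_eq_maxAtoms h0 s
    exact hfs ▸ h f hf

lemma FinitelyAtomic.maxAtoms_lt_iff_measure {K : Measure (C0 T)} (hK : FinitelyAtomic K) {s : T}
    {r : ℝ} (hr : 0 < r) : maxAtoms K s < r ↔ K {f | r ≤ f.1 s} = 0 := by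
  rw [hK.maxAtoms_lt_iff hr, hK.null_iff (measurableSet_le measurable_const (measurable_eval s))]
  simp

lemma FinitelyAtomic.extremalAt {K : Measure (C0 T)} (hK : FinitelyAtomic K) (s : T) :
    FinitelyAtomic (extremalAt s K) :=
  hK.restrict _ (measurableSet_eq_fun (measurable_eval s) measurable_const)

lemma mem_atoms_extremalAt {K : Measure (C0 T)} {s : T} {f : C0 T} :
    f ∈ atoms (extremalAt s K) ↔ f ∈ atoms K ∧ f.1 s = maxAtoms K s := by
  rw [MaxId.extremalAt, atoms_restrict]; rfl

/-- The extremal atoms at `s` have the same maximum at `s` as all atoms. -/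
lemma FinitelyAtomic.maxAtoms_extremalAt {K : Measure (C0 T)} (hK : FinitelyAtomic K) (s : T) :
    maxAtoms (MaxId.extremalAt s K) s = maxAtoms K s := by
  rcases (atoms K).eq_empty_or_nonempty with h0 | h0
  · rw [maxAtoms_of_atoms_eq_empty h0, maxAtoms_of_atoms_eq_empty]
    ext f; simp [mem_atoms_extremalAt, h0]
  · obtain ⟨f, hf, hfs⟩ := hK.exists_eq_maxAtoms h0 s
    refine le_antisymm ?_ ?_
    · rw [(hK.extremalAt s).maxAtoms_le_iff (maxAtoms_nonneg K s)]
      exact fun g hg => (mem_atoms_extremalAt.1 hg).2.le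
    · rw [← hfs]
      exact (hK.extremalAt s).le_maxAtoms (mem_atoms_extremalAt.2 ⟨hf, hfs⟩) s

end Maxima

/-! ### Measurable dependence on parameters -/

section Measurability

variable {A : Type*} [MeasurableSpace A]

lemma measurable_restrict_section {E : Type*} [MeasurableSpace E] {κ : A → Measure E}
    (hκ : Measurable κ) (hfin : ∀ a, IsFiniteMeasure (κ a)) {G : A → Set E}
    (hG : MeasurableSet {p : A × E | p.2 ∈ G p.1}) :
    Measurable (fun a => (κ a).restrict (G a)) := by
  refine Measure.measurable_of_measurable_coe _ fun B hB => ?_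
  have h := Kernel.measurable_kernel_prodMk_left_of_finite (κ := ⟨κ, hκ⟩)
    (t := {p : A × E | p.2 ∈ B ∧ p.2 ∈ G p.1}) ((measurable_snd hB).inter hG) hfin
  convert h using 2 with a
  rw [Measure.restrict_apply hB]
  rfl

variable {T : Type*} [TopologicalSpace T]

lemma measurable_maxAtoms {κ : A → Measure (C0 T)} (hκ : Measurable κ)
    (hfin : ∀ a, FinitelyAtomic (κ a)) (s : T) : Measurable (fun a => maxAtoms (κ a) s) := by
  refine measurable_of_Iio fun r => ?_
  rcases le_or_gt r 0 with hr | hr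
  · convert MeasurableSet.empty (α := A) using 1
    ext a
    simpa using hr.trans (maxAtoms_nonneg (κ a) s)
  · have : (fun a => maxAtoms (κ a) s) ⁻¹' Iio r = {a | κ a {f | r ≤ f.1 s} = 0} := by
      ext a; exact (hfin a).maxAtoms_lt_iff_measure hr
    rw [this]
    exact ((Measure.measurable_coe (measurableSet_le measurable_const (measurable_eval s))).comp
      hκ) (measurableSet_singleton 0)

lemma measurable_extremalAt {κ : A → Measure (C0 T)} (hκ : Measurable κ)
    (hfin : ∀ a, FinitelyAtomic (κ a)) (s : T) : Measurable (fun a => extremalAt s (κ a)) :=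
  measurable_restrict_section hκ (fun a => (hfin a).isFiniteMeasure)
    (measurableSet_eq_fun ((measurable_eval s).comp measurable_snd)
      ((measurable_maxAtoms hκ hfin s).comp measurable_fst))

end Measurability

/-! ### The maximal atoms of a finite Poisson random measure -/

section TopAtoms

variable {T : Type*} [TopologicalSpace T] {S : Type*} [MeasurableSpace S] {ρ : Measure S}
  {ν : Measure (C0 T)} {M : S → Measure (C0 T)}

lemma SimulatesFinitePRM.finitelyAtomic (hM : SimulatesFinitePRM ρ ν M) (u : S) :
    FinitelyAtomic (M u) := (hM.2 u).finitelyAtomic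

lemma SimulatesFinitePRM.measurable_maxAtoms_restrict (hM : SimulatesFinitePRM ρ ν M)
    {A : Set (C0 T)} (hA : MeasurableSet A) (s : T) :
    Measurable (fun u => maxAtoms ((M u).restrict A) s) :=
  measurable_maxAtoms
    (measurable_restrict_section hM.1.measurable (fun u => (hM.finitelyAtomic u).isFiniteMeasure)
      (G := fun _ => A) (measurable_snd hA))
    (fun u => (hM.finitelyAtomic u).restrict A hA) s

lemma FinitelyAtomic.maxAtoms_restrict_lt_iff {K : Measure (C0 T)} (hK : FinitelyAtomic K)
    {A : Set (C0 T)} (hA : MeasurableSet A) {s : T} {r : ℝ} (hr : 0 < r) :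
    maxAtoms (K.restrict A) s < r ↔ K (A ∩ {f | r ≤ f.1 s}) = 0 := by
  have hm : MeasurableSet {f : C0 T | r ≤ f.1 s} :=
    measurableSet_le measurable_const (measurable_eval s)
  rw [(hK.restrict A hA).maxAtoms_lt_iff_measure hr, Measure.restrict_apply hm, inter_comm]

lemma SimulatesFinitePRM.measure_maxAtoms_lt (hM : SimulatesFinitePRM ρ ν M) {A : Set (C0 T)}
    (hA : MeasurableSet A) (s : T) {r : ℝ} (hr : 0 < r) :
    ρ {u | maxAtoms ((M u).restrict A) s < r} = expNeg (ν (A ∩ {f | r ≤ f.1 s})) := by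
  simp_rw [(hM.finitelyAtomic _).maxAtoms_restrict_lt_iff hA hr]
  exact hM.1.measure_eq_zero
    (hA.inter (measurableSet_le measurable_const (measurable_eval s)))

lemma SimulatesFinitePRM.ae_forall_atoms_ge [IsProbabilityMeasure ρ]
    (hM : SimulatesFinitePRM ρ ν M) {s : T} {c : ℝ} (hν : ν {f | f.1 s < c} = 0) :
    ∀ᵐ u ∂ρ, ∀ f ∈ atoms (M u), c ≤ f.1 s := by
  have hlt : MeasurableSet {f : C0 T | f.1 s < c} :=
    measurableSet_lt (measurable_eval s) measurable_const
  have h1 : ρ {u | M u {f | f.1 s < c} = 0} = 1 := by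
    rw [hM.1.measure_eq_zero hlt, hν, expNeg_zero]
  have hmeas : MeasurableSet {u | M u {f | f.1 s < c} = 0} :=
    ((Measure.measurable_coe hlt).comp hM.1.measurable) (measurableSet_singleton 0)
  filter_upwards [(mem_ae_iff_prob_eq_one hmeas).2 h1] with u hu f hf
  simpa using ((hM.finitelyAtomic u).null_iff hlt).1 hu f hf

/-- The maxima of a Poisson random measure over disjoint sets are independent. -/
lemma SimulatesFinitePRM.indepFun_maxAtoms [IsProbabilityMeasure ρ]
    (hM : SimulatesFinitePRM ρ ν M) {A₁ A₂ : Set (C0 T)} (h₁ : MeasurableSet A₁)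
    (h₂ : MeasurableSet A₂) (hd : Disjoint A₁ A₂) (s : T) :
    IndepFun (fun u => maxAtoms ((M u).restrict A₁) s)
      (fun u => maxAtoms ((M u).restrict A₂) s) ρ := by
  have hm₁ := hM.measurable_maxAtoms_restrict h₁ s
  have hm₂ := hM.measurable_maxAtoms_restrict h₂ s
  have hgen : ∀ H : S → ℝ, MeasurableSpace.comap H inferInstance =
      MeasurableSpace.generateFrom (preimage H '' range Iio) := fun H => by
    rw [← MeasurableSpace.comap_generateFrom, ← borel_eq_generateFrom_Iio]
    exact congrArg _ (BorelSpace.measurable_eq (α := ℝ))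
  have hpi : ∀ H : S → ℝ, IsPiSystem (preimage H '' range Iio) := by
    rintro H _ ⟨_, ⟨a, rfl⟩, rfl⟩ _ ⟨_, ⟨b, rfl⟩, rfl⟩ -
    exact ⟨Iio (min a b), ⟨_, rfl⟩, by rw [← preimage_inter, Iio_inter_Iio]⟩
  rw [IndepFun_iff_Indep, hgen, hgen]
  refine IndepSets.indep' ?_ ?_ (hpi _) (hpi _) ?_
  · rintro _ ⟨_, ⟨a, rfl⟩, rfl⟩; exact hm₁ measurableSet_Iio
  · rintro _ ⟨_, ⟨a, rfl⟩, rfl⟩; exact hm₂ measurableSet_Iio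
  rw [IndepSets_iff]
  rintro _ _ ⟨_, ⟨a, rfl⟩, rfl⟩ ⟨_, ⟨b, rfl⟩, rfl⟩
  have hempty : ∀ {A : Set (C0 T)} {r : ℝ}, r ≤ 0 →
      (fun u => maxAtoms ((M u).restrict A) s) ⁻¹' Iio r = ∅ := fun {A r} hr => by
    ext u; simpa using hr.trans (maxAtoms_nonneg ((M u).restrict A) s)
  rcases le_or_gt a 0 with ha | ha
  · simp [hempty ha]
  rcases le_or_gt b 0 with hb | hb
  · simp [hempty hb]
  have hset : ∀ {A : Set (C0 T)} (hA : MeasurableSet A) {r : ℝ} (hr : 0 < r),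
      (fun u => maxAtoms ((M u).restrict A) s) ⁻¹' Iio r =
        (fun u => M u (A ∩ {f | r ≤ f.1 s})) ⁻¹' {0} := fun hA r hr => by
    ext u; exact (hM.finitelyAtomic u).maxAtoms_restrict_lt_iff hA hr
  have hmr : ∀ r : ℝ, MeasurableSet {f : C0 T | r ≤ f.1 s} := fun r =>
    measurableSet_le measurable_const (measurable_eval s)
  rw [hset h₁ ha, hset h₂ hb]
  have hind := hM.1.indep 2 ![A₁ ∩ {f | a ≤ f.1 s}, A₂ ∩ {f | b ≤ f.1 s}] (by
      intro i; fin_cases i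
      · exact h₁.inter (hmr a)
      · exact h₂.inter (hmr b)) (by
      have hd' : Disjoint (A₁ ∩ {f : C0 T | a ≤ f.1 s}) (A₂ ∩ {f | b ≤ f.1 s}) :=
        hd.mono inter_subset_left inter_subset_left
      intro i j hij
      fin_cases i <;> fin_cases j
      · exact absurd rfl hij
      · exact hd'
      · exact hd'.symm
      · exact absurd rfl hij)
  exact (hind.indepFun (show (0 : Fin 2) ≠ 1 by decide)).measure_inter_preimage_eq_mul _ _
    (measurableSet_singleton 0) (measurableSet_singleton 0)

lemma FinitelyAtomic.maxAtoms_restrict_eq_max {K : Measure (C0 T)} (hK : FinitelyAtomic K)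
    {G B : Set (C0 T)} (hG : MeasurableSet G) (hB : MeasurableSet B) (s : T) :
    maxAtoms (K.restrict G) s =
      max (maxAtoms (K.restrict (G ∩ B)) s) (maxAtoms (K.restrict (G ∩ Bᶜ)) s) := by
  refine le_antisymm ?_ (max_le ?_ ?_)
  · rw [(hK.restrict G hG).maxAtoms_le_iff (le_max_of_le_left (maxAtoms_nonneg _ _))]
    intro f hf
    rw [atoms_restrict] at hf
    by_cases hfB : f ∈ B
    · refine le_max_of_le_left ((hK.restrict _ (hG.inter hB)).le_maxAtoms ?_ s)
      rw [atoms_restrict]; exact ⟨hf.1, hf.2, hfB⟩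
    · refine le_max_of_le_right ((hK.restrict _ (hG.inter hB.compl)).le_maxAtoms ?_ s)
      rw [atoms_restrict]; exact ⟨hf.1, hf.2, hfB⟩
  · rw [(hK.restrict _ (hG.inter hB)).maxAtoms_le_iff (maxAtoms_nonneg _ _)]
    intro f hf
    refine (hK.restrict G hG).le_maxAtoms ?_ s
    rw [atoms_restrict] at hf ⊢; exact ⟨hf.1, hf.2.1⟩
  · rw [(hK.restrict _ (hG.inter hB.compl)).maxAtoms_le_iff (maxAtoms_nonneg _ _)]
    intro f hf
    refine (hK.restrict G hG).le_maxAtoms ?_ s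
    rw [atoms_restrict] at hf ⊢; exact ⟨hf.1, hf.2.1⟩

/-- If all atoms are positive at `s`, then no extremal atom lies in `B` exactly if the atoms in `B`
stay strictly below those outside `B`, or there are none in `B`. -/
lemma FinitelyAtomic.forall_extremal_notMem_iff {K : Measure (C0 T)} (hK : FinitelyAtomic K)
    {G B : Set (C0 T)} (hG : MeasurableSet G) (hB : MeasurableSet B) {s : T}
    (hpos : ∀ f ∈ atoms K, 0 < f.1 s) :
    (∀ f ∈ atoms (MaxId.extremalAt s (K.restrict G)), f ∉ B) ↔
      (maxAtoms (K.restrict (G ∩ B)) s < maxAtoms (K.restrict (G ∩ Bᶜ)) s ∨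
        maxAtoms (K.restrict (G ∩ B)) s ≤ 0) := by
  have hmax := hK.maxAtoms_restrict_eq_max hG hB s
  have hK₁ := hK.restrict _ (hG.inter hB)
  simp only [mem_atoms_extremalAt, atoms_restrict]
  constructor
  · intro h
    by_contra! hc
    have hne : (atoms (K.restrict (G ∩ B))).Nonempty := by
      rw [nonempty_iff_ne_empty]
      intro h0
      exact hc.2.ne' (maxAtoms_of_atoms_eq_empty h0 s)
    obtain ⟨f, hf, hfs⟩ := hK₁.exists_eq_maxAtoms hne s
    rw [atoms_restrict] at hf
    exact h f ⟨⟨hf.1, hf.2.1⟩, by rw [hfs, hmax, max_eq_left hc.1]⟩ hf.2.2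
  · rintro h f ⟨hf, hfs⟩ hfB
    have hle : f.1 s ≤ maxAtoms (K.restrict (G ∩ B)) s :=
      hK₁.le_maxAtoms (by rw [atoms_restrict]; exact ⟨hf.1, hf.2, hfB⟩) s
    rcases h with h | h
    · rw [hfs, hmax] at hle
      exact absurd hle (not_le.2 (lt_max_of_lt_right h))
    · exact absurd (hpos f hf.1) (not_lt.2 (hle.trans h))

open Classical in
/-- The thinning identity behind the algorithm. Reveal only the atoms of a Poisson random measure
that are extremal at `s`, at height `m`; the atoms below height `m` that have not been revealed
form a Poisson random measure with the intensity restricted to `{f | f s < m}`. So the probability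
that no revealed atom and no atom of an independent such Poisson random measure lies in `B` is
the probability that the original one puts no atom into `B`. -/
theorem SimulatesFinitePRM.lintegral_extremal [IsProbabilityMeasure ρ]
    (hM : SimulatesFinitePRM ρ ν M) {s : T} {c : ℝ} (hc : 0 < c) (hν : ν {f | f.1 s < c} = 0)
    {G B : Set (C0 T)} (hG : MeasurableSet G) (hB : MeasurableSet B) :
    ∫⁻ u, (if ∀ f ∈ atoms (extremalAt s ((M u).restrict G)), f ∉ B then
        expNeg (ν (G ∩ B ∩ {f | f.1 s < maxAtoms ((M u).restrict G) s})) else 0) ∂ρ =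
      expNeg (ν (G ∩ B)) := by
  have hGB := hG.inter hB
  have hGB' := hG.inter hB.compl
  set H₁ : S → ℝ := fun u => maxAtoms ((M u).restrict (G ∩ B)) s
  set H₂ : S → ℝ := fun u => maxAtoms ((M u).restrict (G ∩ Bᶜ)) s
  have hm₁ : Measurable H₁ := hM.measurable_maxAtoms_restrict hGB s
  have hm₂ : Measurable H₂ := hM.measurable_maxAtoms_restrict hGB' s
  have hind : IndepFun H₁ H₂ ρ := hM.indepFun_maxAtoms hGB hGB'
    (disjoint_compl_right.mono inter_subset_right inter_subset_right) s
  have hlt : ∀ r : ℝ, MeasurableSet {f : C0 T | f.1 s < r} := fun r =>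
    measurableSet_lt (measurable_eval s) measurable_const
  have hae := hM.ae_forall_atoms_ge hν
  let φ : ℝ → ℝ≥0∞ := fun y => expNeg (ν (G ∩ B ∩ {f | f.1 s < y}))
  have hφ : Measurable φ := by
    refine Antitone.measurable fun a b hab => expNeg_antitone (measure_mono ?_)
    exact inter_subset_inter_right _ fun f (hf : f.1 s < a) => hf.trans_le hab
  let F : ℝ × ℝ → ℝ≥0∞ := fun p => indicator {p : ℝ × ℝ | p.1 < p.2 ∨ p.1 ≤ 0} (fun p => φ p.2) p
  have hFset : MeasurableSet {p : ℝ × ℝ | p.1 < p.2 ∨ p.1 ≤ 0} :=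
    (measurableSet_lt measurable_fst measurable_snd).union
      (measurableSet_le measurable_fst measurable_const)
  have hF : Measurable F := (hφ.comp measurable_snd).indicator hFset
  have hstep1 : ∫⁻ u, (if ∀ f ∈ atoms (extremalAt s ((M u).restrict G)), f ∉ B then
        expNeg (ν (G ∩ B ∩ {f | f.1 s < maxAtoms ((M u).restrict G) s})) else 0) ∂ρ
      = ∫⁻ u, F (H₁ u, H₂ u) ∂ρ := by
    refine lintegral_congr_ae ?_
    filter_upwards [hae] with u hu
    have hiff := (hM.finitelyAtomic u).forall_extremal_notMem_iff hG hB (s := s)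
      (fun f hf => hc.trans_le (hu f hf))
    simp only [F, indicator, mem_ofPred_eq]
    rw [if_congr hiff rfl rfl]
    by_cases h : H₁ u < H₂ u ∨ H₁ u ≤ 0
    · rw [if_pos h, if_pos h]
      simp only [φ]
      rw [(hM.finitelyAtomic u).maxAtoms_restrict_eq_max hG hB s, max_eq_right]
      exact h.elim le_of_lt fun h => h.trans (maxAtoms_nonneg _ _)
    · rw [if_neg h, if_neg h]
  have hprod := (indepFun_iff_map_prod_eq_prod_map_map hm₁.aemeasurable hm₂.aemeasurable).1 hind
  have : IsProbabilityMeasure (ρ.map H₁) := Measure.isProbabilityMeasure_map hm₁.aemeasurable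
  have : IsProbabilityMeasure (ρ.map H₂) := Measure.isProbabilityMeasure_map hm₂.aemeasurable
  rw [hstep1, ← lintegral_map hF (hm₁.prodMk hm₂), hprod, lintegral_prod_symm _ hF.aemeasurable]
  -- for each height `y` of the atoms outside `B` the two factors multiply to the same constant
  have hinner : ∀ y, ∫⁻ x, F (x, y) ∂(ρ.map H₁) = expNeg (ν (G ∩ B)) := by
    intro y
    have hset : MeasurableSet {x : ℝ | x < y ∨ x ≤ 0} :=
      measurableSet_Iio.union measurableSet_Iic
    have h1 : ∫⁻ x, F (x, y) ∂(ρ.map H₁) = φ y * ρ.map H₁ {x | x < y ∨ x ≤ 0} := by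
      have : (fun x => F (x, y)) = indicator {x : ℝ | x < y ∨ x ≤ 0} (fun _ => φ y) := by
        ext x; simp [F, indicator]
      rw [this, lintegral_indicator_const hset]
    rw [h1, Measure.map_apply hm₁ hset]
    rcases le_or_gt y 0 with hy | hy
    · have h2 : ρ (H₁ ⁻¹' {x | x < y ∨ x ≤ 0}) = ρ {u | H₁ u < c} := by
        refine measure_congr ?_
        filter_upwards [hae] with u hu
        refine propext ⟨fun h => ?_, fun h => Or.inr ?_⟩
        · exact (h.elim (fun h => h.le.trans hy) id).trans_lt hc
        · refine (maxAtoms_of_atoms_eq_empty (eq_empty_of_forall_notMem fun f hf => ?_) s).le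
          have h3 := ((hM.finitelyAtomic u).restrict _ hGB).le_maxAtoms hf s
          rw [atoms_restrict] at hf
          exact absurd (h3.trans_lt h) (not_lt.2 (hu f hf.1))
      have h3 : ν (G ∩ B ∩ {f | f.1 s < y}) = 0 :=
        measure_mono_null (fun f hf => lt_of_lt_of_le hf.2 (hy.trans hc.le)) hν
      have h4 : ν (G ∩ B ∩ {f | c ≤ f.1 s}) = ν (G ∩ B) := by
        refine measure_congr ?_
        have : ∀ᵐ f ∂ν, c ≤ f.1 s := by
          rw [ae_iff]; simpa using hν
        filter_upwards [this] with f hf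
        exact propext ⟨fun h => h.1, fun h => ⟨h, hf⟩⟩
      rw [h2, hM.measure_maxAtoms_lt hGB s hc, h4]
      simp [φ, h3]
    · have h2 : H₁ ⁻¹' {x | x < y ∨ x ≤ 0} = {u | H₁ u < y} := by
        ext u
        exact ⟨fun h => h.elim id fun h => lt_of_le_of_lt h hy, Or.inl⟩
      rw [h2, hM.measure_maxAtoms_lt hGB s hy, ← expNeg_add]
      congr 1
      rw [← measure_inter_add_sdiff (G ∩ B) (hlt y)]
      congr 2
      ext f; simp
  simp [hinner]

end TopAtoms

/-! ### One step of the main loop -/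

section Step

variable {T : Type*} [TopologicalSpace T] {d : ℕ} {S : Type*}

/-- The part of a state that matters for the values at the locations `t`: position, number of
passes, and the values of the current path at the locations. -/
def State.coords (t : Fin d → T) (σ : State T) : ℕ × ℕ × (Fin d → ℝ) :=
  (σ.pos, σ.iter, fun k => σ.path (t k))

/-- The functions that can still be atoms of the residual random measure at position `i`, given the
values `x` of the path at the locations. -/
def remaining (t : Fin d → T) (J₀ : Set (Fin d)) (i : ℕ) (x : Fin d → ℝ) : Set (C0 T) :=
  {f | (∀ j ∈ J₀, f.1 (t j) = 0) ∧ ∀ k : Fin d, (k : ℕ) < i → k ∉ J₀ → f.1 (t k) < x k}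

/-- The functions that are not excluded by `n` unsuccessful passes of the while-loop at
position `i`. There is no constraint if no while-loop is run there: for `i = d`, for a location in
`J₀`, and if the path is already non-zero at the location. -/
def window (t : Fin d → T) (J₀ : Set (Fin d)) (c : Fin d → ℝ) (i n : ℕ) (x : Fin d → ℝ) :
    Set (C0 T) :=
  {f | ∀ h : i < d, ⟨i, h⟩ ∉ J₀ → x ⟨i, h⟩ = 0 →
    (f.1 (t ⟨i, h⟩) : EReal) < upperLevel (c ⟨i, h⟩) n}

/-- The functions that exceed the level `y k` at some location `t k`. -/
def exceed (t : Fin d → T) (y : Fin d → ℝ) : Set (C0 T) := {f | ∃ k, y k < f.1 (t k)}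

/-- The values of the path at the locations after the atoms `K` were used to finish a location. -/
noncomputable def updated (t : Fin d → T) (i : Fin d) (K : Measure (C0 T)) (x : Fin d → ℝ) :
    Fin d → ℝ :=
  fun k => max (maxAtoms (extremalAt (t i) K) (t k)) (x k)

lemma residualSet_inter_admissible (t : Fin d → T) (J₀ : Set (Fin d)) (i : Fin d) (x : T → ℝ) :
    residualSet t J₀ ∩ admissible t J₀ i x = remaining t J₀ i (fun k => x (t k)) := rfl

variable {sim : T → ℝ → S → Measure (C0 T)} {t : Fin d → T} {J₀ : Set (Fin d)} {c : Fin d → ℝ}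
  {u : Fin d → ℕ → S} {σ : State T}

lemma step_of_not_lt (h : ¬ σ.pos < d) : step sim t J₀ c u σ = σ := by
  simp [step, h]

lemma step_of_mem (h : σ.pos < d) (hJ : ⟨σ.pos, h⟩ ∈ J₀) :
    step sim t J₀ c u σ = ⟨σ.pos + 1, 0, σ.path⟩ := by
  simp [step, h, hJ]

/-- The atoms that are kept in pass number `n` of the while-loop at location `i`. -/
noncomputable def loopAtoms (sim : T → ℝ → S → Measure (C0 T)) (t : Fin d → T) (J₀ : Set (Fin d))
    (c : Fin d → ℝ) (i : Fin d) (n : ℕ) (x : Fin d → ℝ) (v : S) : Measure (C0 T) :=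
  (sim (t i) (lowerLevel (c i) n) v).restrict
    (remaining t J₀ i x ∩ {f | (f.1 (t i) : EReal) < upperLevel (c i) n})

open Classical in
lemma step_of_eq_zero (h : σ.pos < d) (hJ : ⟨σ.pos, h⟩ ∉ J₀) (h0 : σ.path (t ⟨σ.pos, h⟩) = 0) :
    step sim t J₀ c u σ =
      if loopAtoms sim t J₀ c ⟨σ.pos, h⟩ σ.iter (fun k => σ.path (t k)) (u ⟨σ.pos, h⟩ σ.iter) = 0
      then ⟨σ.pos, σ.iter + 1, σ.path⟩
      else σ.finish (t ⟨σ.pos, h⟩)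
        (loopAtoms sim t J₀ c ⟨σ.pos, h⟩ σ.iter (fun k => σ.path (t k))
          (u ⟨σ.pos, h⟩ σ.iter)) := by
  simp only [step, h, hJ, h0, dite_true, if_true, if_false, loopAtoms]
  rw [inter_right_comm, residualSet_inter_admissible]
  rfl

lemma step_of_ne_zero (h : σ.pos < d) (hJ : ⟨σ.pos, h⟩ ∉ J₀)
    (h0 : σ.path (t ⟨σ.pos, h⟩) ≠ 0) :
    step sim t J₀ c u σ = σ.finish (t ⟨σ.pos, h⟩)
      ((sim (t ⟨σ.pos, h⟩) (σ.path (t ⟨σ.pos, h⟩)) (u ⟨σ.pos, h⟩ σ.iter)).restrict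
        (remaining t J₀ σ.pos (fun k => σ.path (t k)))) := by
  simp only [step, h, hJ, h0, dite_true, if_false]
  rw [residualSet_inter_admissible]

lemma State.coords_finish (i : Fin d) (K : Measure (C0 T)) :
    (σ.finish (t i) K).coords t = (σ.pos + 1, 0, updated t i K (fun k => σ.path (t k))) := rfl

/-- A step reads only the seed at the current position and pass. -/
lemma step_congr {u' : Fin d → ℕ → S} (hu : ∀ h : σ.pos < d, u ⟨σ.pos, h⟩ σ.iter =
    u' ⟨σ.pos, h⟩ σ.iter) : step sim t J₀ c u σ = step sim t J₀ c u' σ := by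
  by_cases h : σ.pos < d
  swap; · rw [step_of_not_lt h, step_of_not_lt h]
  by_cases hJ : ⟨σ.pos, h⟩ ∈ J₀
  · rw [step_of_mem h hJ, step_of_mem h hJ]
  by_cases h0 : σ.path (t ⟨σ.pos, h⟩) = 0
  · rw [step_of_eq_zero h hJ h0, step_of_eq_zero h hJ h0, hu h]
  · rw [step_of_ne_zero h hJ h0, step_of_ne_zero h hJ h0, hu h]

/-- A step before the end of the main loop either repeats the while-loop or moves on to the next
location. -/
lemma step_pos_iter (sim : T → ℝ → S → Measure (C0 T)) (t : Fin d → T) (J₀ : Set (Fin d))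
    (c : Fin d → ℝ) (u : Fin d → ℕ → S) (h : σ.pos < d) :
    ((step sim t J₀ c u σ).pos = σ.pos ∧ (step sim t J₀ c u σ).iter = σ.iter + 1) ∨
      ((step sim t J₀ c u σ).pos = σ.pos + 1 ∧ (step sim t J₀ c u σ).iter = 0) := by
  by_cases hJ : ⟨σ.pos, h⟩ ∈ J₀
  · rw [step_of_mem h hJ]; exact Or.inr ⟨rfl, rfl⟩
  by_cases h0 : σ.path (t ⟨σ.pos, h⟩) = 0
  · rw [step_of_eq_zero h hJ h0]
    split_ifs
    · exact Or.inl ⟨rfl, rfl⟩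
    · exact Or.inr ⟨rfl, rfl⟩
  · rw [step_of_ne_zero h hJ h0]; exact Or.inr ⟨rfl, rfl⟩

lemma path_le_step (σ : State T) (s : T) : σ.path s ≤ (step sim t J₀ c u σ).path s := by
  by_cases h : σ.pos < d
  swap; · rw [step_of_not_lt h]
  by_cases hJ : ⟨σ.pos, h⟩ ∈ J₀
  · rw [step_of_mem h hJ]
  by_cases h0 : σ.path (t ⟨σ.pos, h⟩) = 0
  · rw [step_of_eq_zero h hJ h0]
    split_ifs
    · rfl
    · exact le_max_right _ _
  · rw [step_of_ne_zero h hJ h0]; exact le_max_right _ _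

lemma lowerLevel_pos {a : ℝ} (ha : 0 < a) (n : ℕ) : 0 < lowerLevel a n := by
  unfold lowerLevel; positivity

lemma antitone_lowerLevel {a : ℝ} (ha : 0 ≤ a) : Antitone (lowerLevel a) := fun _ _ hmn =>
  div_le_div_of_nonneg_left ha (by positivity) (pow_le_pow_right₀ one_le_two hmn)

lemma lowerLevel_le_upperLevel {a : ℝ} (ha : 0 < a) (n : ℕ) :
    (lowerLevel a n : EReal) ≤ upperLevel a n := by
  cases n with
  | zero => exact le_top
  | succ n =>
    exact EReal.coe_le_coe_iff.2 (antitone_lowerLevel ha.le n.le_succ)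

lemma tendsto_lowerLevel (a : ℝ) : Tendsto (lowerLevel a) atTop (𝓝 0) :=
  tendsto_const_nhds.div_atTop (tendsto_pow_atTop_atTop_of_one_lt one_lt_two)

lemma measurableSet_remaining (t : Fin d → T) (J₀ : Set (Fin d)) (i : ℕ) :
    MeasurableSet {p : (Fin d → ℝ) × C0 T | p.2 ∈ remaining t J₀ i p.1} := by
  classical
  refine MeasurableSet.inter ?_ ?_
  · refine measurableSet_setOfPred.2 (Measurable.forall fun j => Measurable.imp measurable_const ?_)
    exact measurableSet_setOfPred.1
      (measurableSet_eq_fun ((measurable_eval (t j)).comp measurable_snd) measurable_const)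
  · refine measurableSet_setOfPred.2 (Measurable.forall fun k => Measurable.imp measurable_const
      (Measurable.imp measurable_const ?_))
    exact measurableSet_setOfPred.1 (measurableSet_lt ((measurable_eval (t k)).comp measurable_snd)
      ((measurable_pi_apply k).comp measurable_fst))

lemma measurableSet_remaining_right (t : Fin d → T) (J₀ : Set (Fin d)) (i : ℕ) (x : Fin d → ℝ) :
    MeasurableSet (remaining t J₀ i x) :=
  measurable_prodMk_left (measurableSet_remaining t J₀ i)

lemma measurableSet_eval_lt (s : T) (a : EReal) :
    MeasurableSet {f : C0 T | (f.1 s : EReal) < a} :=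
  measurableSet_lt (measurable_coe_real_ereal.comp (measurable_eval s)) measurable_const

lemma measurableSet_window (t : Fin d → T) (J₀ : Set (Fin d)) (c : Fin d → ℝ) (i n : ℕ) :
    MeasurableSet {p : (Fin d → ℝ) × C0 T | p.2 ∈ window t J₀ c i n p.1} := by
  refine measurableSet_setOfPred.2 (Measurable.forall fun h => Measurable.imp measurable_const
    (Measurable.imp ?_ ?_))
  · exact measurableSet_setOfPred.1 (measurableSet_eq_fun
      ((measurable_pi_apply _).comp measurable_fst) measurable_const)
  · exact measurableSet_setOfPred.1 (measurable_snd (measurableSet_eval_lt _ _))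

lemma measurableSet_exceed (t : Fin d → T) (y : Fin d → ℝ) : MeasurableSet (exceed t y) :=
  measurableSet_setOfPred.2 (Measurable.exists fun k => measurableSet_setOfPred.1
    (measurableSet_lt measurable_const (measurable_eval (t k))))

lemma remaining_succ_of_mem {i : ℕ} (h : i < d) (hJ : ⟨i, h⟩ ∈ J₀) (x : Fin d → ℝ) :
    remaining t J₀ (i + 1) x = remaining t J₀ i x := by
  ext f
  refine and_congr_right fun _ => forall_congr' fun k => ?_
  refine ⟨fun H hk => H (by omega), fun H hk hkJ => H ?_ hkJ⟩
  have : (k : ℕ) ≠ i := by rintro rfl; exact hkJ hJ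
  omega

/-- Discarding at the next location: the candidates are cut off at the new value of the path. -/
lemma remaining_succ_updated {i : Fin d} (hJ : i ∉ J₀) {x : Fin d → ℝ} (hx : ∀ k, 0 ≤ x k)
    {K : Measure (C0 T)} (hK : FinitelyAtomic K) (hsub : atoms K ⊆ remaining t J₀ i x) :
    remaining t J₀ (i + 1) (updated t i K x) =
      remaining t J₀ i x ∩ {f | f.1 (t i) < max (maxAtoms K (t i)) (x i)} := by
  have hold : ∀ k : Fin d, k < i → k ∉ J₀ → updated t i K x k = x k := fun k hk hkJ => by
    refine max_eq_right (((hK.extremalAt _).maxAtoms_le_iff (hx k)).2 fun f hf => ?_)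
    exact ((hsub (mem_atoms_extremalAt.1 hf).1).2 k hk hkJ).le
  have hnew : updated t i K x i = max (maxAtoms K (t i)) (x i) := by
    rw [updated, hK.maxAtoms_extremalAt]
  ext f
  constructor
  · rintro ⟨h1, h2⟩
    refine ⟨⟨h1, fun k hk hkJ => ?_⟩, ?_⟩
    · rw [← hold k hk hkJ]; exact h2 k (by omega) hkJ
    · rw [mem_ofPred_eq, ← hnew]; exact h2 i (by omega) hJ
  · rintro ⟨⟨h1, h2⟩, h3⟩
    refine ⟨h1, fun k hk hkJ => ?_⟩
    rcases (Nat.lt_succ_iff.1 hk).lt_or_eq with hk | hk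
    · rw [hold k hk hkJ]; exact h2 k hk hkJ
    · rw [Fin.ext hk, hnew]; exact h3

lemma updated_le_iff {i : Fin d} {x y : Fin d → ℝ} (hy : ∀ k, 0 ≤ y k) {K : Measure (C0 T)}
    (hK : FinitelyAtomic K) : (∀ k, updated t i K x k ≤ y k) ↔
      (∀ k, x k ≤ y k) ∧ ∀ f ∈ atoms (extremalAt (t i) K), f ∉ exceed t y := by
  simp only [updated, max_le_iff, (hK.extremalAt (t i)).maxAtoms_le_iff (hy _), exceed,
    mem_ofPred_eq, not_exists, not_lt]
  exact ⟨fun h => ⟨fun k => (h k).2, fun f hf k => (h k).1 f hf⟩,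
    fun h k => ⟨fun f hf => h.2 f hf k, h.1 k⟩⟩

lemma window_zero (x : Fin d → ℝ) (i : ℕ) : window t J₀ c i 0 x = univ := by
  refine eq_univ_of_forall fun f h _ _ => ?_
  exact EReal.coe_lt_top _

lemma window_of_mem {i : ℕ} (h : i < d) (hJ : ⟨i, h⟩ ∈ J₀) (n : ℕ) (x : Fin d → ℝ) :
    window t J₀ c i n x = univ :=
  eq_univ_of_forall fun _ _ h' => absurd hJ h'

lemma window_of_ne_zero {i : ℕ} (h : i < d) (n : ℕ) {x : Fin d → ℝ} (h0 : x ⟨i, h⟩ ≠ 0) :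
    window t J₀ c i n x = univ :=
  eq_univ_of_forall fun _ _ _ h' => absurd h' h0

lemma window_of_eq_zero {i : Fin d} (hJ : i ∉ J₀) (n : ℕ) {x : Fin d → ℝ} (h0 : x i = 0) :
    window t J₀ c i n x = {f | (f.1 (t i) : EReal) < upperLevel (c i) n} := by
  ext f
  exact ⟨fun h => h i.2 hJ h0, fun h _ _ _ => h⟩

end Step

section StepMeasurable

variable {T : Type*} [TopologicalSpace T] {d : ℕ} {S : Type*}
  {A : Type*} [MeasurableSpace A]
  {sim : T → ℝ → S → Measure (C0 T)} {t : Fin d → T} {J₀ : Set (Fin d)} {c : Fin d → ℝ}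

lemma measurable_updated (t : Fin d → T) (i : Fin d) {κ : A → Measure (C0 T)} (hκ : Measurable κ)
    (hfin : ∀ a, FinitelyAtomic (κ a)) {x : A → Fin d → ℝ} (hx : Measurable x) :
    Measurable (fun a => updated t i (κ a) (x a)) :=
  measurable_pi_lambda _ fun k =>
    (measurable_maxAtoms (measurable_extremalAt hκ hfin (t i)) (fun a => (hfin a).extremalAt _)
      (t k)).max ((measurable_pi_apply k).comp hx)

lemma finitelyAtomic_loopAtoms (hfin : ∀ s a, 0 < a → ∀ v, FinitelyAtomic (sim s a v))
    (hc : ∀ i, 0 < c i) (i : Fin d) (n : ℕ) (x : Fin d → ℝ) (v : S) :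
    FinitelyAtomic (loopAtoms sim t J₀ c i n x v) :=
  (hfin _ _ (lowerLevel_pos (hc i) n) v).restrict _
    ((measurableSet_remaining_right t J₀ i x).inter (measurableSet_eval_lt _ _))

variable [MeasurableSpace S]

lemma measurable_loopAtoms (hsim : ∀ s, Measurable (fun p : ℝ × S => sim s p.1 p.2))
    (hfin : ∀ s a, 0 < a → ∀ v, FinitelyAtomic (sim s a v)) (hc : ∀ i, 0 < c i) (i : Fin d)
    (n : ℕ) {x : A → Fin d → ℝ} (hx : Measurable x) {v : A → S} (hv : Measurable v) :
    Measurable (fun a => loopAtoms sim t J₀ c i n (x a) (v a)) := by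
  refine measurable_restrict_section ((hsim (t i)).comp (measurable_const.prodMk hv))
    (fun a => (hfin _ _ (lowerLevel_pos (hc i) n) _).isFiniteMeasure) (MeasurableSet.inter ?_ ?_)
  · exact ((hx.comp measurable_fst).prodMk measurable_snd) (measurableSet_remaining t J₀ i)
  · exact measurable_snd (measurableSet_eval_lt _ _)

lemma measurable_coords_step (hsim : ∀ s, Measurable (fun p : ℝ × S => sim s p.1 p.2))
    (hfin : ∀ s a, 0 < a → ∀ v, FinitelyAtomic (sim s a v)) (hc : ∀ i, 0 < c i)
    {σ : A → State T} (hσ : Measurable (fun a => (σ a).coords t))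
    (hσ0 : ∀ a k, 0 ≤ (σ a).path (t k)) {u : A → Fin d → ℕ → S}
    (hu : ∀ i n, Measurable (fun a => u a i n)) :
    Measurable (fun a => (step sim t J₀ c (u a) (σ a)).coords t) := by
  classical
  set x : A → Fin d → ℝ := fun a k => (σ a).path (t k)
  have hx : Measurable x := hσ.snd.snd
  -- countably many positions and pass numbers are treated one by one
  have key : ∀ p : ℕ × ℕ, Measurable
      (fun a => (step sim t J₀ c (u a) ⟨p.1, p.2, (σ a).path⟩).coords t) := by
    rintro ⟨i, n⟩
    by_cases h : i < d
    swap
    · have : ∀ a, step sim t J₀ c (u a) ⟨i, n, (σ a).path⟩ = ⟨i, n, (σ a).path⟩ :=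
        fun a => step_of_not_lt h
      simp_rw [this]
      exact measurable_const.prodMk (measurable_const.prodMk hx)
    by_cases hJ : ⟨i, h⟩ ∈ J₀
    · have : ∀ a, step sim t J₀ c (u a) ⟨i, n, (σ a).path⟩ = ⟨i + 1, 0, (σ a).path⟩ :=
        fun a => step_of_mem (σ := ⟨i, n, (σ a).path⟩) h hJ
      simp_rw [this]
      exact measurable_const.prodMk (measurable_const.prodMk hx)
    have hxi : Measurable (fun a => x a ⟨i, h⟩) := (measurable_pi_apply (⟨i, h⟩ : Fin d)).comp hx
    let L : A → Measure (C0 T) := fun a => loopAtoms sim t J₀ c ⟨i, h⟩ n (x a) (u a ⟨i, h⟩ n)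
    have hL : Measurable L := measurable_loopAtoms hsim hfin hc _ n hx (hu _ _)
    let κ : A → Measure (C0 T) := fun a =>
      if 0 < x a ⟨i, h⟩ then sim (t ⟨i, h⟩) (x a ⟨i, h⟩) (u a ⟨i, h⟩ n) else 0
    have hκ : Measurable κ := Measurable.ite (measurableSet_lt measurable_const hxi)
      ((hsim _).comp (hxi.prodMk (hu _ _))) measurable_const
    have hκfin : ∀ a, FinitelyAtomic (κ a) := fun a => by
      by_cases h0 : 0 < x a ⟨i, h⟩
      · simp only [κ, if_pos h0]; exact hfin _ _ h0 _
      · simp only [κ, if_neg h0]; exact finitelyAtomic_zero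
    have hκ' : Measurable (fun a => (κ a).restrict (remaining t J₀ i (x a))) :=
      measurable_restrict_section hκ (fun a => (hκfin a).isFiniteMeasure)
        (((hx.comp measurable_fst).prodMk measurable_snd) (measurableSet_remaining t J₀ i))
    have hκfin' : ∀ a, FinitelyAtomic ((κ a).restrict (remaining t J₀ i (x a))) :=
      fun a => (hκfin a).restrict _ (measurableSet_remaining_right t J₀ i _)
    have heq : (fun a => (step sim t J₀ c (u a) ⟨i, n, (σ a).path⟩).coords t) = fun a =>
        if x a ⟨i, h⟩ = 0 then
          if L a univ = 0 then (i, n + 1, x a) else (i + 1, 0, updated t ⟨i, h⟩ (L a) (x a))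
        else (i + 1, 0,
          updated t ⟨i, h⟩ ((κ a).restrict (remaining t J₀ i (x a))) (x a)) := by
      funext a
      by_cases h0 : x a ⟨i, h⟩ = 0
      · rw [if_pos h0, step_of_eq_zero (σ := ⟨i, n, (σ a).path⟩) h hJ h0]
        simp only [Measure.measure_univ_eq_zero]
        by_cases h1 : L a = 0
        · rw [if_pos h1, if_pos h1]; rfl
        · rw [if_neg h1, if_neg h1]; rfl
      · have hpos : 0 < x a ⟨i, h⟩ := (hσ0 a _).lt_of_ne' h0
        rw [if_neg h0, step_of_ne_zero (σ := ⟨i, n, (σ a).path⟩) h hJ h0]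
        simp only [κ, if_pos hpos]
        rfl
    rw [heq]
    refine Measurable.ite (hxi (measurableSet_singleton 0)) (Measurable.ite ?_ ?_ ?_) ?_
    · exact ((Measure.measurable_coe MeasurableSet.univ).comp hL) (measurableSet_singleton 0)
    · exact measurable_const.prodMk (measurable_const.prodMk hx)
    · exact measurable_const.prodMk (measurable_const.prodMk (measurable_updated t _ hL
        (fun a => finitelyAtomic_loopAtoms hfin hc _ _ _ _) hx))
    · exact measurable_const.prodMk (measurable_const.prodMk
        (measurable_updated t _ hκ' hκfin' hx))
  exact (measurable_from_prod_countable_right (f := fun q : (ℕ × ℕ) × A =>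
    (step sim t J₀ c (u q.2) ⟨q.1.1, q.1.2, (σ q.2).path⟩).coords t) key).comp
      ((hσ.fst.prodMk hσ.snd.fst).prodMk measurable_id)

end StepMeasurable

/-! ### The martingale -/

section Potential

variable {T : Type*} [TopologicalSpace T] {d : ℕ} {S : Type*} [MeasurableSpace S]
  {ρ : Measure S} [IsProbabilityMeasure ρ] {μ : Measure (C0 T)}
  {sim : T → ℝ → S → Measure (C0 T)} {t : Fin d → T} {J₀ : Set (Fin d)} {c : Fin d → ℝ}

open Classical in
/-- The conditional probability, given the coordinates of the current state, that the final path
stays below `y` at all locations: the current path does so already, and the part of the residual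
random measure that is still to be explored, a Poisson random measure on `remaining ∩ window`,
has no atom in `exceed t y`. -/
noncomputable def potential (μ : Measure (C0 T)) (t : Fin d → T) (J₀ : Set (Fin d))
    (c : Fin d → ℝ) (y : Fin d → ℝ) (z : ℕ × ℕ × (Fin d → ℝ)) : ℝ≥0∞ :=
  if ∀ k, z.2.2 k ≤ y k then
    expNeg (μ (remaining t J₀ z.1 z.2.2 ∩ window t J₀ c z.1 z.2.1 z.2.2 ∩ exceed t y))
  else 0

lemma potential_of_le {y : Fin d → ℝ} {i n : ℕ} {x : Fin d → ℝ} (h : ∀ k, x k ≤ y k) :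
    potential μ t J₀ c y (i, n, x) =
      expNeg (μ (remaining t J₀ i x ∩ window t J₀ c i n x ∩ exceed t y)) := if_pos h

lemma potential_of_not_le {y : Fin d → ℝ} {i n : ℕ} {x : Fin d → ℝ} (h : ¬ ∀ k, x k ≤ y k) :
    potential μ t J₀ c y (i, n, x) = 0 := if_neg h

lemma potential_le_one (y : Fin d → ℝ) (z : ℕ × ℕ × (Fin d → ℝ)) :
    potential μ t J₀ c y z ≤ 1 := by
  unfold potential; split_ifs
  · exact expNeg_le_one _
  · exact zero_le

lemma measurable_measure_remaining_inter_window (c : Fin d → ℝ) (i n : ℕ) (B : Set (C0 T))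
    (hB : MeasurableSet B) [SFinite (μ.restrict B)] :
    Measurable (fun x => μ (remaining t J₀ i x ∩ window t J₀ c i n x ∩ B)) := by
  have h := measurable_measure_prodMk_left (ν := μ.restrict B)
    ((measurableSet_remaining t J₀ i).inter (measurableSet_window t J₀ c i n))
  convert h using 2 with x
  exact (Measure.restrict_apply' hB).symm

lemma measurable_potential (y : Fin d → ℝ) [SFinite (μ.restrict (exceed t y))] :
    Measurable (potential μ t J₀ c y) := by
  refine measurable_from_prod_countable_right fun i => measurable_from_prod_countable_right
    fun n => Measurable.ite ?_ ?_ measurable_const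
  · exact measurableSet_setOfPred.2 (Measurable.forall fun k => measurableSet_setOfPred.1
      (measurableSet_le (measurable_pi_apply k) measurable_const))
  · exact measurable_expNeg.comp
      (measurable_measure_remaining_inter_window c i n _ (measurableSet_exceed t y))

lemma restrict_ge_apply_lt (μ : Measure (C0 T)) (s : T) (a : ℝ) :
    (μ.restrict {f : C0 T | a ≤ f.1 s}) {f | f.1 s < a} = 0 := by
  rw [Measure.restrict_apply (measurableSet_lt (measurable_eval s) measurable_const)]
  convert measure_empty (μ := μ)
  ext f; simp

open Classical in
/-- The thinning identity for a slab `{a ≤ f s < b}`, with the unexplored atoms below height `a`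
included. -/
lemma lintegral_extremal_slab {M : S → Measure (C0 T)} {s : T} {a : ℝ} (ha : 0 < a)
    (hM : SimulatesFinitePRM ρ (μ.restrict {f : C0 T | a ≤ f.1 s}) M) {b : EReal}
    (hab : (a : EReal) ≤ b) {R B : Set (C0 T)} (hR : MeasurableSet R) (hB : MeasurableSet B) :
    ∫⁻ v, (if ∀ f ∈ atoms (extremalAt s ((M v).restrict (R ∩ {f | (f.1 s : EReal) < b}))), f ∉ B
      then expNeg (μ (R ∩ B ∩ {f |
        f.1 s < max (maxAtoms ((M v).restrict (R ∩ {f | (f.1 s : EReal) < b})) s) a}))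
      else 0) ∂ρ = expNeg (μ (R ∩ B ∩ {f | (f.1 s : EReal) < b})) := by
  set G : Set (C0 T) := R ∩ {f | (f.1 s : EReal) < b} with hGdef
  have hG : MeasurableSet G := hR.inter (measurableSet_eval_lt s b)
  have hlt : ∀ r : ℝ, MeasurableSet {f : C0 T | f.1 s < r} := fun r =>
    measurableSet_lt (measurable_eval s) measurable_const
  have hge : MeasurableSet {f : C0 T | a ≤ f.1 s} :=
    measurableSet_le measurable_const (measurable_eval s)
  have hmain := hM.lintegral_extremal ha (restrict_ge_apply_lt μ s a) hG hB
  have hsplit : ∀ m : ℝ, (m : EReal) ≤ b → expNeg (μ (R ∩ B ∩ {f | f.1 s < max m a})) =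
      expNeg (μ (R ∩ B ∩ {f | f.1 s < a})) *
        expNeg ((μ.restrict {f : C0 T | a ≤ f.1 s}) (G ∩ B ∩ {f | f.1 s < m})) := by
    intro m hm
    rw [← expNeg_add, Measure.restrict_apply' hge,
      ← measure_inter_add_sdiff (R ∩ B ∩ {f | f.1 s < max m a}) (hlt a)]
    congr 3
    · ext f
      simp only [mem_inter_iff, mem_ofPred_eq, lt_max_iff]
      tauto
    · ext f
      simp only [hGdef, mem_inter_iff, Set.mem_sdiff, mem_ofPred_eq, lt_max_iff, not_lt]
      constructor
      · rintro ⟨⟨h1, h2⟩, h3⟩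
        have h4 : f.1 s < m := h2.resolve_right (not_lt.2 h3)
        exact ⟨⟨⟨⟨h1.1, (EReal.coe_lt_coe_iff.2 h4).trans_le hm⟩, h1.2⟩, h4⟩, h3⟩
      · rintro ⟨⟨⟨⟨h1, -⟩, h2⟩, h3⟩, h4⟩
        exact ⟨⟨⟨h1, h2⟩, Or.inl h3⟩, h4⟩
  have hm : ∀ v, (maxAtoms ((M v).restrict G) s : EReal) ≤ b := by
    intro v
    have hK := (hM.finitelyAtomic v).restrict G hG
    rcases (atoms ((M v).restrict G)).eq_empty_or_nonempty with h0 | h0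
    · rw [maxAtoms_of_atoms_eq_empty h0]
      exact (EReal.coe_le_coe_iff.2 ha.le).trans hab
    · obtain ⟨f, hf, hfs⟩ := hK.exists_eq_maxAtoms h0 s
      rw [atoms_restrict] at hf
      rw [← hfs]
      exact le_of_lt hf.2.2
  calc _ = ∫⁻ v, expNeg (μ (R ∩ B ∩ {f | f.1 s < a})) *
        (if ∀ f ∈ atoms (extremalAt s ((M v).restrict G)), f ∉ B then
        expNeg ((μ.restrict {f : C0 T | a ≤ f.1 s})
          (G ∩ B ∩ {f | f.1 s < maxAtoms ((M v).restrict G) s})) else 0) ∂ρ := by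
        refine lintegral_congr fun v => ?_
        rw [mul_ite, mul_zero, hsplit _ (hm v)]
    _ = expNeg (μ (R ∩ B ∩ {f | f.1 s < a})) *
        expNeg ((μ.restrict {f : C0 T | a ≤ f.1 s}) (G ∩ B)) := by
        rw [lintegral_const_mul' _ _ ((expNeg_le_one _).trans_lt ENNReal.one_lt_top).ne, hmain]
    _ = _ := by
        rw [← expNeg_add, Measure.restrict_apply' hge,
          ← measure_inter_add_sdiff (R ∩ B ∩ {f | (f.1 s : EReal) < b}) (hlt a)]
        congr 3
        · ext f
          simp only [mem_inter_iff, mem_ofPred_eq]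
          constructor
          · exact fun h => ⟨⟨h.1, (EReal.coe_lt_coe_iff.2 h.2).trans_le hab⟩, h.2⟩
          · exact fun h => ⟨h.1.1, h.2⟩
        · ext f
          simp only [hGdef, mem_inter_iff, Set.mem_sdiff, mem_ofPred_eq, not_lt]
          tauto

/-- The potential after the atoms `K` were used to finish location `i`, in terms of the candidates
before: those that reach the new value of the path at `t i` are excluded. -/
lemma potential_updated {i : Fin d} (hJ : i ∉ J₀) {x y : Fin d → ℝ} (hx : ∀ k, 0 ≤ x k)
    (hy : ∀ k, 0 ≤ y k) {K : Measure (C0 T)} (hK : FinitelyAtomic K)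
    (hsub : atoms K ⊆ remaining t J₀ i x) :
    potential μ t J₀ c y (i + 1, 0, updated t i K x) = open Classical in
      if ∀ k, x k ≤ y k then
        if ∀ f ∈ atoms (extremalAt (t i) K), f ∉ exceed t y then
          expNeg (μ (remaining t J₀ i x ∩ exceed t y ∩
            {f | f.1 (t i) < max (maxAtoms K (t i)) (x i)}))
        else 0
      else 0 := by
  classical
  rw [potential]
  simp only
  rw [window_zero, inter_univ, remaining_succ_updated hJ hx hK hsub, if_congr (updated_le_iff hy hK)
    rfl rfl, ite_and, inter_right_comm]

/-- The martingale property: a step with a fresh seed preserves the expected potential. -/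
theorem lintegral_potential_step
    (hsim : ∀ s a, 0 < a → SimulatesFinitePRM ρ (μ.restrict {f : C0 T | a ≤ f.1 s}) (sim s a))
    (hc : ∀ i, 0 < c i) {y : Fin d → ℝ} (hy : ∀ k, 0 ≤ y k) (σ : State T)
    (hσ : ∀ k, 0 ≤ σ.path (t k)) :
    ∫⁻ v, potential μ t J₀ c y ((step sim t J₀ c (fun _ _ => v) σ).coords t) ∂ρ =
      potential μ t J₀ c y (σ.coords t) := by
  classical
  have hfin : ∀ s a, 0 < a → ∀ v, FinitelyAtomic (sim s a v) :=
    fun s a ha => (hsim s a ha).finitelyAtomic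
  by_cases h : σ.pos < d
  swap; · simp [step_of_not_lt h]
  by_cases hJ : ⟨σ.pos, h⟩ ∈ J₀
  · simp only [step_of_mem h hJ, lintegral_const, measure_univ, mul_one]
    by_cases hxy : ∀ k, σ.path (t k) ≤ y k
    · rw [State.coords, State.coords, potential_of_le hxy, potential_of_le hxy,
        remaining_succ_of_mem h hJ, window_of_mem h hJ, window_zero]
    · rw [State.coords, State.coords, potential_of_not_le hxy, potential_of_not_le hxy]
  set i : Fin d := ⟨σ.pos, h⟩
  set x : Fin d → ℝ := fun k => σ.path (t k)
  set R := remaining t J₀ i x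
  have hRm : MeasurableSet R := measurableSet_remaining_right t J₀ i x
  have hBm := measurableSet_exceed t y
  by_cases h0 : σ.path (t i) = 0
  · set a := lowerLevel (c i) σ.iter
    have hapos : 0 < a := lowerLevel_pos (hc i) _
    set b := upperLevel (c i) σ.iter
    have hM := hsim (t i) a hapos
    have hlow : ∀ᵐ v ∂ρ, ∀ f ∈ atoms (sim (t i) a v), a ≤ f.1 (t i) :=
      hM.ae_forall_atoms_ge (restrict_ge_apply_lt μ (t i) a)
    have hnext : ∀ᵐ v ∂ρ, potential μ t J₀ c y ((step sim t J₀ c (fun _ _ => v) σ).coords t) =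
        if ∀ k, x k ≤ y k then
          if ∀ f ∈ atoms (extremalAt (t i) ((sim (t i) a v).restrict
            (R ∩ {f | (f.1 (t i) : EReal) < b}))), f ∉ exceed t y then
          expNeg (μ (R ∩ exceed t y ∩ {f | f.1 (t i) <
            max (maxAtoms ((sim (t i) a v).restrict
              (R ∩ {f | (f.1 (t i) : EReal) < b})) (t i)) a}))
          else 0
        else 0 := by
      filter_upwards [hlow] with v hv
      rw [step_of_eq_zero h hJ h0]
      have hK := finitelyAtomic_loopAtoms (t := t) (J₀ := J₀) hfin hc i σ.iter x v
      have hKeq : loopAtoms sim t J₀ c i σ.iter x v =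
        (sim (t i) a v).restrict (R ∩ {f | (f.1 (t i) : EReal) < b}) := rfl
      by_cases hK0 : loopAtoms sim t J₀ c i σ.iter x v = 0
      · have hempty := hK.eq_zero_iff.1 hK0
        rw [if_pos hK0, ← hKeq, maxAtoms_of_atoms_eq_empty hempty, max_eq_right hapos.le]
        have : ∀ f ∈ atoms (extremalAt (t i) (loopAtoms sim t J₀ c i σ.iter x v)),
            f ∉ exceed t y := by
          simp [mem_atoms_extremalAt, hempty]
        rw [if_pos this]
        simp only [potential, State.coords]
        rw [window_of_eq_zero (i := i) hJ _ h0, inter_right_comm]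
        simp only [upperLevel, EReal.coe_lt_coe_iff]
        rfl
      · rw [if_neg hK0, State.coords_finish, ← hKeq]
        refine (potential_updated (i := i) hJ hσ hy hK ?_).trans ?_
        · rw [hKeq, atoms_restrict]; exact fun f hf => hf.2.1
        · have hne : (atoms (loopAtoms sim t J₀ c i σ.iter x v)).Nonempty := by
            rw [nonempty_iff_ne_empty]; exact fun h' => hK0 (hK.eq_zero_iff.2 h')
          obtain ⟨f, hf, hfs⟩ := hK.exists_eq_maxAtoms hne (t i)
          have hle : a ≤ maxAtoms (loopAtoms sim t J₀ c i σ.iter x v) (t i) := by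
            rw [← hfs]
            rw [hKeq, atoms_restrict] at hf
            exact hv f hf.1
          have hx0 : σ.path (t i) = 0 := h0
          rw [max_eq_left hle, hx0, max_eq_left (maxAtoms_nonneg _ _)]
    rw [lintegral_congr_ae hnext]
    have hslab := lintegral_extremal_slab hapos hM (lowerLevel_le_upperLevel (hc i) σ.iter) hRm hBm
    by_cases hxy : ∀ k, x k ≤ y k
    · simp only [hxy, if_true, implies_true]
      rw [hslab, State.coords, potential_of_le hxy, window_of_eq_zero (i := i) hJ _ h0,
        inter_right_comm]
    · simp only [hxy, if_false, lintegral_zero]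
      rw [State.coords, potential_of_not_le hxy]
  · have hapos : 0 < σ.path (t i) := (hσ i).lt_of_ne' h0
    have hM := hsim (t i) _ hapos
    have hslab := lintegral_extremal_slab (b := ⊤) hapos hM le_top hRm hBm
    have htop : {f : C0 T | (f.1 (t i) : EReal) < ⊤} = univ :=
      eq_univ_of_forall fun f => EReal.coe_lt_top _
    simp only [htop, inter_univ] at hslab
    have hnext : ∀ v, potential μ t J₀ c y ((step sim t J₀ c (fun _ _ => v) σ).coords t) =
        if ∀ k, x k ≤ y k then
          if ∀ f ∈ atoms (extremalAt (t i) ((sim (t i) (σ.path (t i)) v).restrict R)),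
            f ∉ exceed t y then
          expNeg (μ (R ∩ exceed t y ∩ {f | f.1 (t i) <
            max (maxAtoms ((sim (t i) (σ.path (t i)) v).restrict R) (t i)) (σ.path (t i))}))
          else 0
        else 0 := by
      intro v
      rw [step_of_ne_zero h hJ h0, State.coords_finish]
      refine potential_updated (i := i) hJ hσ hy ((hfin _ _ hapos v).restrict R hRm) ?_
      rw [atoms_restrict]; exact inter_subset_right
    simp only [hnext]
    by_cases hxy : ∀ k, x k ≤ y k
    · simp only [hxy, if_true, implies_true]
      rw [hslab, State.coords, potential_of_le hxy, window_of_ne_zero h _ (x := x) h0, inter_univ]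
    · simp only [hxy, if_false, lintegral_zero]
      rw [State.coords, potential_of_not_le hxy]

end Potential

/-! ### Fresh seeds -/

/-- The seed `U p` may be integrated out if the remaining integrand depends on the seeds other than
`U p` only. -/
theorem lintegral_fresh {ι S Ω₀ : Type*} [MeasurableSpace S] [MeasurableSpace Ω₀]
    {Q : Measure Ω₀} [IsProbabilityMeasure Q] {ρ : Measure S} [IsProbabilityMeasure ρ]
    {U : ι → Ω₀ → S} (hUm : ∀ q, Measurable (U q)) (hUl : ∀ q, HasLaw (U q) ρ Q)
    (hUi : iIndepFun U Q) (p : ι) {G : (ι → S) → S → ℝ≥0∞}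
    (hG : Measurable (Function.uncurry G))
    (hGp : ∀ v v' : ι → S, (∀ q ≠ p, v q = v' q) → G v = G v') :
    ∫⁻ ω, G (fun q => U q ω) (U p ω) ∂Q = ∫⁻ ω, ∫⁻ s, G (fun q => U q ω) s ∂ρ ∂Q := by
  classical
  obtain ⟨ω₀⟩ : Nonempty Ω₀ := nonempty_of_isProbabilityMeasure Q
  let Y : Ω₀ → ι → S := fun ω => Function.update (fun q => U q ω) p (U p ω₀)
  have hYm : Measurable Y := measurable_pi_lambda _ fun q => by
    by_cases hq : q = p
    · subst hq; simp [Y]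
    · simpa [Y, hq] using hUm q
  have hYle : Measurable[⨆ q ∈ {q | q ≠ p}, MeasurableSpace.comap (U q) inferInstance] Y := by
    refine @measurable_pi_lambda _ _ _ (_) _ _ fun q => ?_
    by_cases hq : q = p
    · subst hq; simp only [Y, Function.update_self]; exact @measurable_const _ _ _ (_) _
    · simp only [Y, Function.update_of_ne hq]
      exact (comap_measurable (U q)).mono
        (le_iSup₂_of_le (f := fun q (_ : q ∈ {q | q ≠ p}) => MeasurableSpace.comap (U q) _)
          q hq le_rfl) le_rfl
  have hYG : ∀ ω, G (fun q => U q ω) = G (Y ω) := fun ω =>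
    hGp _ _ fun q hq => by simp [Y, hq]
  have hind : IndepFun Y (U p) Q := by
    rw [IndepFun_iff_Indep]
    have h := indep_iSup_of_disjoint (fun q => (hUm q).comap_le) hUi
      (S := {q | q ≠ p}) (T := {p}) (by simp)
    refine indep_of_indep_of_le_left (indep_of_indep_of_le_right h ?_) ?_
    · exact le_iSup₂_of_le p rfl le_rfl
    · exact hYle.comap_le
  have hprod := (indepFun_iff_map_prod_eq_prod_map_map hYm.aemeasurable
    (hUm p).aemeasurable).1 hind
  have : IsProbabilityMeasure (Q.map Y) := Measure.isProbabilityMeasure_map hYm.aemeasurable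
  simp only [hYG]
  calc ∫⁻ ω, G (Y ω) (U p ω) ∂Q
      = ∫⁻ z, Function.uncurry G z ∂(Q.map (fun ω => (Y ω, U p ω))) :=
        (lintegral_map hG (hYm.prodMk (hUm p))).symm
    _ = ∫⁻ y, ∫⁻ s, G y s ∂ρ ∂(Q.map Y) := by
        rw [hprod, (hUl p).map_eq, lintegral_prod _ hG.aemeasurable]; rfl
    _ = _ := lintegral_map hG.lintegral_prod_right' hYm

/-! ### The run of the main loop -/

lemma State.coords_init {T : Type*} {d : ℕ} (t : Fin d → T) :
    (State.init T).coords t = (0, 0, 0) := rfl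

/-- The state is in pass number `n` at location `i`. -/
def State.At {T : Type*} (σ : State T) (i n : ℕ) : Prop := σ.pos = i ∧ σ.iter = n

/-- The state has left pass number `n` at location `i`. -/
def State.After {T : Type*} (σ : State T) (i n : ℕ) : Prop := i < σ.pos ∨ (σ.pos = i ∧ n < σ.iter)

lemma State.At.not_after {T : Type*} {σ : State T} {i n : ℕ} (h : σ.At i n) : ¬ σ.After i n := by
  unfold State.At at h
  unfold State.After
  omega

lemma measurableSet_at {T : Type*} {d : ℕ} {t : Fin d → T} {A : Type*} [MeasurableSpace A]
    {σ : A → State T} (hσ : Measurable (fun a => (σ a).coords t)) (i n : ℕ) :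
    MeasurableSet {a | (σ a).At i n} :=
  (hσ.fst (measurableSet_singleton i)).inter (hσ.snd.fst (measurableSet_singleton n))

/-- Two integrals agree if they agree on each of the countably many events that fix the position and
the pass number of a random state. -/
lemma lintegral_congr_of_at {T Ω₀ : Type*} [MeasurableSpace Ω₀] {Q : Measure Ω₀}
    {σ : Ω₀ → State T}
    (hσ : ∀ i n, MeasurableSet {ω | (σ ω).At i n}) {H H' : Ω₀ → ℝ≥0∞}
    (h : ∀ i n, ∫⁻ ω in {ω | (σ ω).At i n}, H ω ∂Q = ∫⁻ ω in {ω | (σ ω).At i n}, H' ω ∂Q) :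
    ∫⁻ ω, H ω ∂Q = ∫⁻ ω, H' ω ∂Q := by
  let E : ℕ × ℕ → Set Ω₀ := fun p => {ω | (σ ω).At p.1 p.2}
  have hEd : Pairwise (Function.onFun Disjoint E) := by
    intro p q hpq
    refine Set.disjoint_left.2 fun ω hp hq => hpq (Prod.ext ?_ ?_)
    · exact hp.1.symm.trans hq.1
    · exact hp.2.symm.trans hq.2
  have hEu : ⋃ p, E p = univ :=
    eq_univ_of_forall fun ω => mem_iUnion.2 ⟨((σ ω).pos, (σ ω).iter), rfl, rfl⟩
  have hsplit : ∀ K : Ω₀ → ℝ≥0∞, ∫⁻ ω, K ω ∂Q = ∑' p, ∫⁻ ω in E p, K ω ∂Q := fun K => by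
    rw [← lintegral_iUnion (s := E) (fun p => hσ p.1 p.2) hEd, hEu, setLIntegral_univ]
  rw [hsplit, hsplit]
  exact tsum_congr fun p => h p.1 p.2

section Run

variable {T : Type*} [TopologicalSpace T] {d : ℕ} {S : Type*}
  {sim : T → ℝ → S → Measure (C0 T)} {t : Fin d → T} {J₀ : Set (Fin d)} {c : Fin d → ℝ}

lemma run_zero (u : Fin d → ℕ → S) : run sim t J₀ c u 0 = State.init T := rfl

lemma run_succ (u : Fin d → ℕ → S) (m : ℕ) :
    run sim t J₀ c u (m + 1) = step sim t J₀ c u (run sim t J₀ c u m) :=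
  Function.iterate_succ_apply' _ _ _

lemma path_run_nonneg (u : Fin d → ℕ → S) (m : ℕ) (s : T) :
    0 ≤ (run sim t J₀ c u m).path s := by
  induction m with
  | zero => exact le_rfl
  | succ m ih => rw [run_succ]; exact ih.trans (path_le_step _ s)

lemma State.After.step {σ : State T} {i n : ℕ} (h : σ.After i n) (u : Fin d → ℕ → S) :
    (step sim t J₀ c u σ).After i n := by
  by_cases hd : σ.pos < d
  · have h' := step_pos_iter sim t J₀ c u hd
    generalize MaxId.step sim t J₀ c u σ = τ at h' ⊢
    unfold State.After at h ⊢
    omega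
  · rwa [step_of_not_lt hd]

lemma State.At.after_step {σ : State T} {i n : ℕ} (h : σ.At i n) (hi : i < d)
    (u : Fin d → ℕ → S) : (step sim t J₀ c u σ).After i n := by
  have h' := step_pos_iter sim t J₀ c u (h.1 ▸ hi)
  generalize MaxId.step sim t J₀ c u σ = τ at h' ⊢
  unfold State.At at h
  unfold State.After
  omega

/-- Two runs whose seeds differ at `(i, n)` only agree until they read this seed. -/
lemma run_eq_or_after {u u' : Fin d → ℕ → S} {i : Fin d} {n : ℕ}
    (hu : ∀ j l, (j, l) ≠ (i, n) → u j l = u' j l) (m : ℕ) :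
    (run sim t J₀ c u m = run sim t J₀ c u' m) ∨
      ((run sim t J₀ c u m).After i n ∧ (run sim t J₀ c u' m).After i n) := by
  induction m with
  | zero => rw [run_zero, run_zero]; exact Or.inl rfl
  | succ m ih =>
    rw [run_succ, run_succ]
    rcases ih with h1 | ⟨h1, h2⟩
    · rw [← h1]
      generalize run sim t J₀ c u m = σ
      by_cases hat : σ.At i n
      · exact Or.inr ⟨hat.after_step i.2 u, hat.after_step i.2 u'⟩
      · left
        refine step_congr fun hd => hu _ _ fun hq => hat ?_
        rw [Prod.mk.injEq] at hq
        exact ⟨congrArg Fin.val hq.1, hq.2⟩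
    · exact Or.inr ⟨h1.step u, h2.step u'⟩

/-- The state at the moment at which the seed `(i, n)` is about to be read does not depend on this
seed. -/
lemma run_congr_of_at {u u' : Fin d → ℕ → S} {i : Fin d} {n : ℕ}
    (hu : ∀ j l, (j, l) ≠ (i, n) → u j l = u' j l) (m : ℕ)
    (h : (run sim t J₀ c u m).At i n) : run sim t J₀ c u' m = run sim t J₀ c u m :=
  (run_eq_or_after hu m).elim Eq.symm fun h' => absurd h'.1 h.not_after

variable [MeasurableSpace S]

lemma measurable_coords_run {A : Type*} [MeasurableSpace A]
    (hsim : ∀ s, Measurable (fun p : ℝ × S => sim s p.1 p.2))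
    (hfin : ∀ s a, 0 < a → ∀ v, FinitelyAtomic (sim s a v)) (hc : ∀ i, 0 < c i)
    {u : A → Fin d → ℕ → S} (hu : ∀ i n, Measurable (fun a => u a i n)) (m : ℕ) :
    Measurable (fun a => (run sim t J₀ c (u a) m).coords t) := by
  induction m with
  | zero => simp only [run_zero]; exact measurable_const
  | succ m ih =>
    simp only [run_succ]
    exact measurable_coords_step hsim hfin hc ih (fun _ _ => path_run_nonneg _ _ _) hu

variable {ρ : Measure S} [IsProbabilityMeasure ρ]
  {Ω₀ : Type*} [MeasurableSpace Ω₀] {Q : Measure Ω₀} [IsProbabilityMeasure Q]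
  {U : Fin d × ℕ → Ω₀ → S}

/-- On the event that the state is in pass `n` at location `i`, the next step uses a fresh seed. -/
lemma setLIntegral_step_fresh (hsim : ∀ s, Measurable (fun p : ℝ × S => sim s p.1 p.2))
    (hfin : ∀ s a, 0 < a → ∀ v, FinitelyAtomic (sim s a v)) (hc : ∀ i, 0 < c i)
    (hUm : ∀ q, Measurable (U q)) (hUl : ∀ q, HasLaw (U q) ρ Q) (hUi : iIndepFun U Q)
    {W : (Fin d × ℕ → S) → ℝ≥0∞} (hW : Measurable W) {i : Fin d} {n : ℕ}
    (hWp : ∀ v v' : Fin d × ℕ → S, (∀ q ≠ (i, n), v q = v' q) → W v = W v')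
    {F : ℕ × ℕ × (Fin d → ℝ) → ℝ≥0∞} (hF : Measurable F)
    {R : (Fin d × ℕ → S) → State T} (hR : Measurable (fun v => (R v).coords t))
    (hR0 : ∀ v k, 0 ≤ (R v).path (t k))
    (hRat : ∀ v v' : Fin d × ℕ → S, (∀ q ≠ (i, n), v q = v' q) → (R v).At i n → R v' = R v) :
    ∫⁻ ω in {ω | (R (fun q => U q ω)).At i n}, W (fun q => U q ω) *
        F ((step sim t J₀ c (fun i n => U (i, n) ω) (R (fun q => U q ω))).coords t) ∂Q =
      ∫⁻ ω in {ω | (R (fun q => U q ω)).At i n}, W (fun q => U q ω) *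
        ∫⁻ s, F ((step sim t J₀ c (fun _ _ => s) (R (fun q => U q ω))).coords t) ∂ρ ∂Q := by
  classical
  have hV : Measurable (fun ω => fun q => U q ω) := measurable_pi_lambda _ hUm
  have hset : MeasurableSet {ω | (R (fun q => U q ω)).At i n} :=
    hV (measurableSet_at hR i n)
  let H : (Fin d × ℕ → S) → S → ℝ≥0∞ := fun v s =>
    F ((step sim t J₀ c (fun _ _ => s) (R v)).coords t)
  have hH : Measurable (Function.uncurry H) :=
    hF.comp (measurable_coords_step hsim hfin hc (hR.comp measurable_fst)
      (fun _ _ => hR0 _ _) (fun _ _ => measurable_snd))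
  have hstep : ∀ ω, (R (fun q => U q ω)).At i n →
      F ((step sim t J₀ c (fun i n => U (i, n) ω) (R (fun q => U q ω))).coords t) =
        H (fun q => U q ω) (U (i, n) ω) := by
    intro ω h
    refine congrArg F (congrArg _ (step_congr fun hd => ?_))
    exact congrArg (fun q => U q ω) (Prod.ext (Fin.ext h.1) h.2)
  have hHp : ∀ v v' : Fin d × ℕ → S, (∀ q ≠ (i, n), v q = v' q) → (R v).At i n →
      H v' = H v := fun v v' hv h => by simp only [H, hRat v v' hv h]
  change _ = ∫⁻ ω in {ω | (R (fun q => U q ω)).At i n}, W (fun q => U q ω) *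
        ∫⁻ s, H (fun q => U q ω) s ∂ρ ∂Q
  rw [setLIntegral_congr_fun hset (fun ω h => congrArg (W (fun q => U q ω) * ·) (hstep ω h))]
  clear hstep
  clear_value H
  let G : (Fin d × ℕ → S) → S → ℝ≥0∞ := fun v s => if (R v).At i n then W v * H v s else 0
  have hG : Measurable (Function.uncurry G) :=
    Measurable.ite (measurable_fst (measurableSet_at hR i n))
      ((hW.comp measurable_fst).mul hH) measurable_const
  have hGp : ∀ v v' : Fin d × ℕ → S, (∀ q ≠ (i, n), v q = v' q) → G v = G v' := by
    intro v v' hv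
    funext s
    simp only [G]
    by_cases h : (R v).At i n
    · rw [hHp v v' hv h, hRat v v' hv h, hWp v v' hv]
    · have h' : ¬ (R v').At i n := fun h' => h (by
        rwa [hRat v' v (fun q hq => (hv q hq).symm) h'])
      rw [if_neg h, if_neg h']
  have hmain := lintegral_fresh hUm hUl hUi (i, n) hG hGp
  rw [← lintegral_indicator hset, ← lintegral_indicator hset]
  refine Eq.trans (lintegral_congr fun ω => ?_) (hmain.trans (lintegral_congr fun ω => ?_))
  · by_cases h : (R (fun q => U q ω)).At i n
    · simp [G, h]
    · simp [G, h]
  · by_cases h : (R (fun q => U q ω)).At i n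
    · have : Measurable (H (fun q => U q ω)) := hH.comp measurable_prodMk_left
      simp [G, h, lintegral_const_mul _ this]
    · simp [G, h]

lemma setLIntegral_run_succ (hsim : ∀ s, Measurable (fun p : ℝ × S => sim s p.1 p.2))
    (hfin : ∀ s a, 0 < a → ∀ v, FinitelyAtomic (sim s a v)) (hc : ∀ i, 0 < c i)
    (hUm : ∀ q, Measurable (U q)) (hUl : ∀ q, HasLaw (U q) ρ Q) (hUi : iIndepFun U Q)
    {W : (Fin d × ℕ → S) → ℝ≥0∞} (hW : Measurable W) {i : Fin d} {n : ℕ}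
    (hWp : ∀ v v' : Fin d × ℕ → S, (∀ q ≠ (i, n), v q = v' q) → W v = W v')
    {F : ℕ × ℕ × (Fin d → ℝ) → ℝ≥0∞} (hF : Measurable F) (m : ℕ) :
    ∫⁻ ω in {ω | (run sim t J₀ c (fun i n => U (i, n) ω) m).At i n},
        W (fun q => U q ω) * F ((run sim t J₀ c (fun i n => U (i, n) ω) (m + 1)).coords t) ∂Q =
      ∫⁻ ω in {ω | (run sim t J₀ c (fun i n => U (i, n) ω) m).At i n},
        W (fun q => U q ω) * ∫⁻ s, F ((step sim t J₀ c (fun _ _ => s)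
          (run sim t J₀ c (fun i n => U (i, n) ω) m)).coords t) ∂ρ ∂Q := by
  simp only [run_succ]
  exact setLIntegral_step_fresh hsim hfin hc hUm hUl hUi hW hWp hF
    (R := fun v => run sim t J₀ c (fun i n => v (i, n)) m)
    (measurable_coords_run hsim hfin hc (fun i n => measurable_pi_apply (i, n)) m)
    (fun _ _ => path_run_nonneg _ _ _)
    (fun v v' hv h => run_congr_of_at (fun j l hq => hv (j, l) hq) m h)

variable {μ : Measure (C0 T)}

/-- The potential is a martingale along the run, also when it is weighted with a function `W` of
seeds that the main loop does not read. -/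
theorem lintegral_potential_run (hsim_meas : ∀ s, Measurable (fun p : ℝ × S => sim s p.1 p.2))
    (hsim : ∀ s a, 0 < a → SimulatesFinitePRM ρ (μ.restrict {f : C0 T | a ≤ f.1 s}) (sim s a))
    (hc : ∀ i, 0 < c i)
    (hUm : ∀ q, Measurable (U q)) (hUl : ∀ q, HasLaw (U q) ρ Q) (hUi : iIndepFun U Q)
    {W : (Fin d × ℕ → S) → ℝ≥0∞} (hW : Measurable W)
    (hWp : ∀ v v' : Fin d × ℕ → S, (∀ q : Fin d × ℕ, q.1 ∈ J₀ → v q = v' q) → W v = W v')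
    {y : Fin d → ℝ} (hy : ∀ k, 0 ≤ y k) [SFinite (μ.restrict (exceed t y))] (m : ℕ) :
    ∫⁻ ω, W (fun q => U q ω) *
        potential μ t J₀ c y ((run sim t J₀ c (fun i n => U (i, n) ω) m).coords t) ∂Q =
      (∫⁻ ω, W (fun q => U q ω) ∂Q) * potential μ t J₀ c y (0, 0, 0) := by
  have hfin : ∀ s a, 0 < a → ∀ v, FinitelyAtomic (sim s a v) :=
    fun s a ha => (hsim s a ha).finitelyAtomic
  have hV : Measurable (fun ω => fun q => U q ω) := measurable_pi_lambda _ hUm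
  have hWm : Measurable (fun ω => W (fun q => U q ω)) := hW.comp hV
  induction m with
  | zero =>
    simp only [run_zero, State.coords_init]
    exact lintegral_mul_const _ hWm
  | succ m ih =>
    rw [← ih]
    have hR : Measurable (fun ω => (run sim t J₀ c (fun i n => U (i, n) ω) m).coords t) :=
      measurable_coords_run hsim_meas hfin hc (fun i n => hUm (i, n)) m
    refine lintegral_congr_of_at (fun i n => measurableSet_at hR i n) fun i n => ?_
    have hmart : ∀ ω, ∫⁻ s, potential μ t J₀ c y ((step sim t J₀ c (fun _ _ => s)
        (run sim t J₀ c (fun i n => U (i, n) ω) m)).coords t) ∂ρ = potential μ t J₀ c y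
        ((run sim t J₀ c (fun i n => U (i, n) ω) m).coords t) := fun ω =>
      lintegral_potential_step hsim hc hy _ (fun k => path_run_nonneg _ _ _)
    by_cases h : ∃ h : i < d, ⟨i, h⟩ ∉ J₀
    · obtain ⟨h, hJ⟩ := h
      have := setLIntegral_run_succ (t := t) (i := ⟨i, h⟩) (n := n) (J₀ := J₀) hsim_meas hfin hc
        hUm hUl hUi hW (fun v v' hv => hWp v v' fun q hq => hv q (by rintro rfl; exact hJ hq))
        (measurable_potential (μ := μ) (t := t) (J₀ := J₀) (c := c) y) m
      simp only [hmart] at this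
      exact this
    · refine setLIntegral_congr_fun (measurableSet_at hR i n) fun ω hω => ?_
      -- no seed is read here, so the step is deterministic
      have hdet : ∀ s, run sim t J₀ c (fun i n => U (i, n) ω) (m + 1) =
          step sim t J₀ c (fun _ _ => s) (run sim t J₀ c (fun i n => U (i, n) ω) m) := by
        intro s
        rw [run_succ]
        have hi : (run sim t J₀ c (fun i n => U (i, n) ω) m).pos = i := hω.1
        generalize run sim t J₀ c (fun i n => U (i, n) ω) m = σ at hi
        subst hi
        by_cases hd : σ.pos < d
        · have hJ : ⟨σ.pos, hd⟩ ∈ J₀ := by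
            by_contra hJ
            exact h ⟨hd, hJ⟩
          rw [step_of_mem hd hJ, step_of_mem hd hJ]
        · rw [step_of_not_lt hd, step_of_not_lt hd]
      have h' := hmart ω
      simp only [← hdet, lintegral_const, measure_univ, mul_one] at h'
      exact congrArg _ h'

end Run

/-! ### Termination -/

section Termination

variable {T : Type*} [TopologicalSpace T] {d : ℕ} {S : Type*}
  {sim : T → ℝ → S → Measure (C0 T)} {t : Fin d → T} {J₀ : Set (Fin d)} {c : Fin d → ℝ}
  {μ : Measure (C0 T)}

/-- At the locations outside `J₀` that are done, the path is positive. -/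
def State.PosBefore (t : Fin d → T) (J₀ : Set (Fin d)) (σ : State T) : Prop :=
  ∀ k : Fin d, (k : ℕ) < σ.pos → k ∉ J₀ → 0 < σ.path (t k)

lemma State.PosBefore.step (hfin : ∀ s a, 0 < a → ∀ v, FinitelyAtomic (sim s a v))
    (hc : ∀ i, 0 < c i) {u : Fin d → ℕ → S}
    (hu : ∀ i n, ∀ f ∈ atoms (sim (t i) (lowerLevel (c i) n) (u i n)),
      lowerLevel (c i) n ≤ f.1 (t i)) {σ : State T} (hσ0 : ∀ k, 0 ≤ σ.path (t k))
    (hσ : σ.PosBefore t J₀) : (step sim t J₀ c u σ).PosBefore t J₀ := by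
  by_cases h : σ.pos < d
  swap; · rwa [step_of_not_lt h]
  -- only the location in progress needs an argument
  have key : 0 < (MaxId.step sim t J₀ c u σ).path (t ⟨σ.pos, h⟩) ∨
      (MaxId.step sim t J₀ c u σ).pos = σ.pos ∨ ⟨σ.pos, h⟩ ∈ J₀ := by
    by_cases hJ : ⟨σ.pos, h⟩ ∈ J₀
    · exact Or.inr (Or.inr hJ)
    by_cases h0 : σ.path (t ⟨σ.pos, h⟩) = 0
    · rw [step_of_eq_zero h hJ h0]
      split_ifs with h1
      · exact Or.inr (Or.inl rfl)
      · left
        have hK := finitelyAtomic_loopAtoms (t := t) (J₀ := J₀) hfin hc ⟨σ.pos, h⟩ σ.iter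
          (fun k => σ.path (t k)) (u ⟨σ.pos, h⟩ σ.iter)
        have hne : (atoms (loopAtoms sim t J₀ c ⟨σ.pos, h⟩ σ.iter (fun k => σ.path (t k))
            (u ⟨σ.pos, h⟩ σ.iter))).Nonempty := by
          rw [nonempty_iff_ne_empty]; exact fun h' => h1 (hK.eq_zero_iff.2 h')
        obtain ⟨f, hf, hfs⟩ := hK.exists_eq_maxAtoms hne (t ⟨σ.pos, h⟩)
        refine lt_max_of_lt_left ?_
        rw [hK.maxAtoms_extremalAt, ← hfs]
        rw [loopAtoms, atoms_restrict] at hf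
        exact (lowerLevel_pos (hc _) _).trans_le (hu _ _ f hf.1)
    · left
      exact ((hσ0 _).lt_of_ne' h0).trans_le (path_le_step σ _)
  intro k hk hkJ
  rcases lt_or_ge (k : ℕ) σ.pos with hlt | hge
  · exact (hσ k hlt hkJ).trans_le (path_le_step σ _)
  · have hpos := step_pos_iter sim t J₀ c u h
    have hkp : (k : ℕ) = σ.pos := by omega
    have hk' : k = ⟨σ.pos, h⟩ := Fin.ext hkp
    rw [hk'] at hkJ ⊢
    rcases key with h1 | h1 | h1
    · exact h1
    · omega
    · exact absurd h1 hkJ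

lemma posBefore_run (hfin : ∀ s a, 0 < a → ∀ v, FinitelyAtomic (sim s a v))
    (hc : ∀ i, 0 < c i) {u : Fin d → ℕ → S}
    (hu : ∀ i n, ∀ f ∈ atoms (sim (t i) (lowerLevel (c i) n) (u i n)),
      lowerLevel (c i) n ≤ f.1 (t i)) (m : ℕ) : (run sim t J₀ c u m).PosBefore t J₀ := by
  induction m with
  | zero => rw [run_zero]; intro k hk; exact absurd hk (Nat.not_lt_zero _)
  | succ m ih =>
    rw [run_succ]
    exact ih.step hfin hc hu (fun _ => path_run_nonneg _ _ _)

/-- The candidates for the atoms at a location outside `J₀` have infinite mass: the exclusions made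
so far remove only a set of finite mass. -/
lemma measure_remaining_eq_top (hμ : ∀ s : T, ∀ ε : ℝ, 0 < ε → μ {f : C0 T | ε < f.1 s} < ∞)
    (hJ₀ : ∀ j ∈ J₀, μ {f : C0 T | 0 < f.1 (t j)} < ∞) {i : Fin d}
    (hi : μ {f : C0 T | 0 < f.1 (t i)} = ∞) {x : Fin d → ℝ}
    (hx : ∀ k < i, k ∉ J₀ → 0 < x k) :
    μ (remaining t J₀ i x ∩ {f | 0 < f.1 (t i)}) = ∞ := by
  classical
  let B : Fin d → Set (C0 T) := fun k =>
    if k ∈ J₀ then {f | 0 < f.1 (t k)} else if k < i then {f | x k ≤ f.1 (t k)} else ∅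
  have hB : ∀ k, μ (B k) < ∞ := by
    intro k
    simp only [B]
    split_ifs with h1 h2
    · exact hJ₀ k h1
    · have hk := hx k h2 h1
      have hsub : {f : C0 T | x k ≤ f.1 (t k)} ⊆ {f | x k / 2 < f.1 (t k)} :=
        fun f hf => (half_lt_self hk).trans_le hf
      exact (measure_mono hsub).trans_lt (hμ (t k) (x k / 2) (half_pos hk))
    · simp
  have hsub : {f : C0 T | 0 < f.1 (t i)} ⊆
      (remaining t J₀ i x ∩ {f | 0 < f.1 (t i)}) ∪ ⋃ k, B k := by
    intro f hf
    by_cases hfB : ∃ k, f ∈ B k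
    · exact Or.inr (mem_iUnion.2 hfB)
    · push Not at hfB
      refine Or.inl ⟨⟨fun j hj => ?_, fun k hk hkJ => ?_⟩, hf⟩
      · have := hfB j
        simp only [B, if_pos hj, mem_ofPred_eq, not_lt] at this
        exact le_antisymm this (f.2.1 _)
      · have := hfB k
        have hk' : k < i := hk
        simpa only [B, if_neg hkJ, if_pos hk', mem_ofPred_eq, not_le] using this
  by_contra hne
  have h1 : μ (⋃ k, B k) < ∞ :=
    (measure_iUnion_le B).trans_lt
      (by rw [tsum_fintype]; exact ENNReal.sum_lt_top.2 fun k _ => hB k)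
  have h2 := (measure_mono (μ := μ) hsub).trans (measure_union_le _ _)
  rw [hi] at h2
  exact (ENNReal.add_lt_top.2 ⟨lt_top_iff_ne_top.2 hne, h1⟩).not_ge h2

lemma tendsto_measure_remaining {i : Fin d} {x : Fin d → ℝ} (hc : 0 < c i)
    (h : μ (remaining t J₀ i x ∩ {f | 0 < f.1 (t i)}) = ∞) :
    Tendsto (fun n => μ (remaining t J₀ i x ∩ {f | lowerLevel (c i) n ≤ f.1 (t i)})) atTop
      (𝓝 ∞) := by
  have hanti := antitone_lowerLevel hc.le
  have hU : ⋃ n, (remaining t J₀ i x ∩ {f | lowerLevel (c i) n ≤ f.1 (t i)}) =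
      remaining t J₀ i x ∩ {f | 0 < f.1 (t i)} := by
    rw [← inter_iUnion]
    congr 1
    ext f
    simp only [mem_iUnion, mem_ofPred_eq]
    constructor
    · rintro ⟨n, hn⟩; exact (lowerLevel_pos hc n).trans_le hn
    · intro hf
      obtain ⟨n, hn⟩ := ((tendsto_lowerLevel (c i)).eventually (gt_mem_nhds hf)).exists
      exact ⟨n, le_of_lt hn⟩
  rw [← h, ← hU]
  refine tendsto_measure_iUnion_atTop fun m n hmn => ?_
  exact inter_subset_inter_right _ fun f hf => (hanti hmn).trans hf

open Classical in
/-- At pass `n` of location `i`, and if the path still vanishes at `t i`: the conditional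
probability that all further passes down to the lower level `ℓ` are unsuccessful. It is `0` in all
other passes and at all other locations. -/
noncomputable def stayProb (μ : Measure (C0 T)) (t : Fin d → T) (J₀ : Set (Fin d))
    (c : Fin d → ℝ) (i : Fin d) (ℓ : ℝ) (n : ℕ) (z : ℕ × ℕ × (Fin d → ℝ)) : ℝ≥0∞ :=
  if z.1 = i ∧ z.2.1 = n then
    expNeg (μ (remaining t J₀ i z.2.2 ∩
      ({f | ℓ ≤ f.1 (t i)} ∩ {f | (f.1 (t i) : EReal) < upperLevel (c i) n})))
  else 0

lemma measurable_stayProb (hμ : ∀ s : T, ∀ ε : ℝ, 0 < ε → μ {f : C0 T | ε < f.1 s} < ∞)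
    (i : Fin d) {ℓ : ℝ} (hℓ : 0 < ℓ) (n : ℕ) : Measurable (stayProb μ t J₀ c i ℓ n) := by
  set B : Set (C0 T) := {f | ℓ ≤ f.1 (t i)} ∩ {f | (f.1 (t i) : EReal) < upperLevel (c i) n}
  have hB : MeasurableSet B := (measurableSet_le measurable_const (measurable_eval _)).inter
    (measurableSet_eval_lt _ _)
  have : IsFiniteMeasure (μ.restrict B) := by
    refine ⟨?_⟩
    rw [Measure.restrict_apply_univ]
    refine (measure_mono fun f hf => ?_).trans_lt (hμ (t i) (ℓ / 2) (half_pos hℓ))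
    exact (half_lt_self hℓ).trans_le hf.1
  have hm : Measurable (fun x => μ (remaining t J₀ i x ∩ B)) := by
    convert measurable_measure_prodMk_left (ν := μ.restrict B)
      (measurableSet_remaining t J₀ i) using 2 with x
    exact (Measure.restrict_apply' hB).symm
  refine Measurable.ite ?_ ?_ measurable_const
  · exact (measurable_fst (measurableSet_singleton (i : ℕ))).inter
      ((measurable_fst.comp measurable_snd) (measurableSet_singleton n))
  · exact measurable_expNeg.comp (hm.comp (measurable_snd.comp measurable_snd))

lemma State.At.of_step {σ : State T} {u : Fin d → ℕ → S} {i n : ℕ} (hi : i < d)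
    (h : (step sim t J₀ c u σ).At i (n + 1)) : σ.At i n := by
  by_cases hd : σ.pos < d
  · have h' := step_pos_iter sim t J₀ c u hd
    generalize MaxId.step sim t J₀ c u σ = τ at h h'
    unfold State.At at h ⊢
    omega
  · rw [step_of_not_lt hd] at h
    exact absurd (h.1 ▸ hi) hd

/-- The algorithm can only fail to stop by staying in the while-loop of one location forever. -/
lemma terminates_of_forall {u : Fin d → ℕ → S}
    (h : ∀ i : Fin d, i ∉ J₀ → ∀ m, ¬ ∀ n, (run sim t J₀ c u (m + n)).At i n) :
    Terminates sim t J₀ c u := by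
  have key : ∀ i ≤ d, ∃ m, (run sim t J₀ c u m).At i 0 := by
    intro i
    induction i with
    | zero => exact fun _ => ⟨0, rfl, rfl⟩
    | succ i ih =>
      intro hi
      obtain ⟨m, hm⟩ := ih (by omega)
      by_cases hJ : ⟨i, hi⟩ ∈ J₀
      · refine ⟨m + 1, ?_⟩
        rw [run_succ]
        generalize run sim t J₀ c u m = σ at hm
        obtain ⟨p, q, path⟩ := σ
        obtain ⟨rfl, rfl⟩ : p = i ∧ q = 0 := hm
        rw [step_of_mem (σ := ⟨p, 0, path⟩) hi hJ]
        exact ⟨rfl, rfl⟩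
      · classical
        have hex : ∃ n, ¬ (run sim t J₀ c u (m + n)).At i n := by
          by_contra! hc'
          exact h ⟨i, hi⟩ hJ m hc'
        -- the first step at which the while-loop is left
        obtain ⟨n, hn, hmin⟩ : ∃ n, ¬ (run sim t J₀ c u (m + n)).At i n ∧
            ∀ l < n, (run sim t J₀ c u (m + l)).At i l :=
          ⟨Nat.find hex, Nat.find_spec hex, fun l hl => not_not.1 (Nat.find_min hex hl)⟩
        cases n with
        | zero => exact absurd hm hn
        | succ n =>
          have h1 := hmin n (Nat.lt_succ_self n)
          refine ⟨m + (n + 1), ?_⟩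
          rw [← add_assoc, run_succ] at hn ⊢
          generalize run sim t J₀ c u (m + n) = σ at h1 hn
          have h2 := step_pos_iter sim t J₀ c u (h1.1 ▸ hi : σ.pos < d)
          generalize MaxId.step sim t J₀ c u σ = τ at h2 hn
          unfold State.At at h1 hn ⊢
          omega
  obtain ⟨m, hm⟩ := key d le_rfl
  exact ⟨m, hm.1⟩

variable [MeasurableSpace S] {ρ : Measure S} [IsProbabilityMeasure ρ]

/-- The supermartingale property of `stayProb`. It is strict only if the path is already positive
at `t i`, because then the location is finished at once. -/
lemma lintegral_stayProb_step
    (hsim : ∀ s a, 0 < a → SimulatesFinitePRM ρ (μ.restrict {f : C0 T | a ≤ f.1 s}) (sim s a))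
    (hc : ∀ i, 0 < c i) {i : Fin d} (hJ : i ∉ J₀) {n : ℕ} {ℓ : ℝ}
    (hℓ : ℓ ≤ lowerLevel (c i) n) {σ : State T} (hat : σ.At i n) :
    ∫⁻ v, stayProb μ t J₀ c i ℓ (n + 1) ((step sim t J₀ c (fun _ _ => v) σ).coords t) ∂ρ ≤
      stayProb μ t J₀ c i ℓ n (σ.coords t) := by
  classical
  obtain ⟨p, q, path⟩ := σ
  obtain ⟨rfl, rfl⟩ : p = i ∧ q = n := hat
  have hi : (i : ℕ) < d := i.2
  by_cases h0 : path (t i) = 0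
  swap
  · have : ∀ v, stayProb μ t J₀ c i ℓ (q + 1)
        ((step sim t J₀ c (fun _ _ => v) ⟨i, q, path⟩).coords t) = 0 := fun v => by
      rw [step_of_ne_zero (σ := ⟨i, q, path⟩) hi hJ h0, State.coords_finish]
      exact if_neg (by simp)
    simp [this]
  set x : Fin d → ℝ := fun k => path (t k)
  set R := remaining t J₀ i x
  set a := lowerLevel (c i) q
  set W : Set (C0 T) := {f | (f.1 (t i) : EReal) < upperLevel (c i) q}
  have hR : MeasurableSet R := measurableSet_remaining_right t J₀ i x
  have hW : MeasurableSet W := measurableSet_eval_lt _ _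
  have hM := hsim (t i) a (lowerLevel_pos (hc i) q)
  have hlt : MeasurableSet {f : C0 T | f.1 (t i) < a} :=
    measurableSet_lt (measurable_eval _) measurable_const
  have hge : MeasurableSet {f : C0 T | a ≤ f.1 (t i)} :=
    measurableSet_le measurable_const (measurable_eval _)
  have hset : MeasurableSet {v | sim (t i) a v (R ∩ W) = 0} :=
    ((Measure.measurable_coe (hR.inter hW)).comp hM.1.measurable) (measurableSet_singleton 0)
  have hstep : ∀ v, stayProb μ t J₀ c i ℓ (q + 1)
      ((step sim t J₀ c (fun _ _ => v) ⟨i, q, path⟩).coords t) =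
      indicator {v | sim (t i) a v (R ∩ W) = 0} (fun _ => expNeg (μ (R ∩
        ({f | ℓ ≤ f.1 (t i)} ∩ {f | f.1 (t i) < a})))) v := by
    intro v
    rw [step_of_eq_zero (σ := ⟨i, q, path⟩) hi hJ h0]
    have hiff : loopAtoms sim t J₀ c i q x v = 0 ↔ sim (t i) a v (R ∩ W) = 0 :=
      Measure.restrict_eq_zero
    by_cases h1 : sim (t i) a v (R ∩ W) = 0
    · rw [if_pos (hiff.2 h1), indicator_of_mem (by exact h1)]
      refine (if_pos ⟨rfl, rfl⟩).trans ?_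
      simp only [upperLevel, EReal.coe_lt_coe_iff]
      rfl
    · rw [if_neg (fun h => h1 (hiff.1 h)), indicator_of_notMem (by exact h1)]
      exact if_neg (by simp [State.coords_finish])
  simp_rw [hstep]
  rw [lintegral_indicator_const hset, hM.1.measure_eq_zero (hR.inter hW),
    Measure.restrict_apply' hge, ← expNeg_add]
  refine le_of_eq (Eq.trans ?_ (if_pos ⟨rfl, rfl⟩).symm)
  congr 1
  change _ = μ (R ∩ ({f | ℓ ≤ f.1 (t i)} ∩ W))
  rw [← measure_inter_add_sdiff (R ∩ ({f | ℓ ≤ f.1 (t i)} ∩ W)) hlt]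
  congr 2
  · ext f
    constructor
    · rintro ⟨h1, h2, h3⟩
      exact ⟨⟨h1, h2, (EReal.coe_lt_coe_iff.2 h3).trans_le
        (lowerLevel_le_upperLevel (hc i) q)⟩, h3⟩
    · rintro ⟨⟨h1, h2, -⟩, h3⟩
      exact ⟨h1, h2, h3⟩
  · ext f
    constructor
    · rintro ⟨⟨h1, h2⟩, h3⟩
      exact ⟨⟨h1, hℓ.trans h3, h2⟩, fun h => (lt_of_lt_of_le (show f.1 (t i) < a from h) h3).false⟩
    · rintro ⟨⟨h1, h2, h3⟩, h4⟩
      exact ⟨⟨h1, h3⟩, show a ≤ f.1 (t i) from le_of_not_gt h4⟩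

variable {Ω₀ : Type*} [MeasurableSpace Ω₀] {Q : Measure Ω₀} [IsProbabilityMeasure Q]
  {U : Fin d × ℕ → Ω₀ → S}

/-- The supermartingale `stayProb` along the passes of the while-loop. -/
lemma lintegral_stayProb_run (hsim_meas : ∀ s, Measurable (fun p : ℝ × S => sim s p.1 p.2))
    (hsim : ∀ s a, 0 < a → SimulatesFinitePRM ρ (μ.restrict {f : C0 T | a ≤ f.1 s}) (sim s a))
    (hc : ∀ i, 0 < c i) (hμ : ∀ s : T, ∀ ε : ℝ, 0 < ε → μ {f : C0 T | ε < f.1 s} < ∞)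
    (hUm : ∀ q, Measurable (U q)) (hUl : ∀ q, HasLaw (U q) ρ Q) (hUi : iIndepFun U Q)
    {i : Fin d} (hJ : i ∉ J₀) {ℓ : ℝ} (hℓ0 : 0 < ℓ) (m : ℕ) {n : ℕ}
    (hℓ : ∀ l < n, ℓ ≤ lowerLevel (c i) l) :
    ∫⁻ ω, stayProb μ t J₀ c i ℓ n
        ((run sim t J₀ c (fun i n => U (i, n) ω) (m + n)).coords t) ∂Q ≤
      ∫⁻ ω, stayProb μ t J₀ c i ℓ 0
        ((run sim t J₀ c (fun i n => U (i, n) ω) m).coords t) ∂Q := by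
  have hfin : ∀ s a, 0 < a → ∀ v, FinitelyAtomic (sim s a v) :=
    fun s a ha => (hsim s a ha).finitelyAtomic
  induction n with
  | zero => exact le_rfl
  | succ n ih =>
    refine le_trans ?_ (ih fun l hl => hℓ l (by omega))
    have hR : Measurable (fun ω => (run sim t J₀ c (fun i n => U (i, n) ω) (m + n)).coords t) :=
      measurable_coords_run hsim_meas hfin hc (fun i n => hUm (i, n)) (m + n)
    have hset := measurableSet_at hR i n
    have h1 := setLIntegral_run_succ (t := t) (J₀ := J₀) (i := i) (n := n) hsim_meas hfin hc hUm
      hUl hUi (W := fun _ => 1) measurable_const (fun _ _ _ => rfl)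
      (measurable_stayProb (t := t) (J₀ := J₀) (c := c) hμ i hℓ0 (n + 1)) (m + n)
    simp only [one_mul] at h1
    have h2 : ∫⁻ ω, stayProb μ t J₀ c i ℓ (n + 1)
        ((run sim t J₀ c (fun i n => U (i, n) ω) (m + n + 1)).coords t) ∂Q =
      ∫⁻ ω in {ω | (run sim t J₀ c (fun i n => U (i, n) ω) (m + n)).At i n},
        stayProb μ t J₀ c i ℓ (n + 1)
          ((run sim t J₀ c (fun i n => U (i, n) ω) (m + n + 1)).coords t) ∂Q := by
      rw [← lintegral_indicator hset]
      refine lintegral_congr fun ω => ?_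
      by_cases h : ω ∈ {ω | (run sim t J₀ c (fun i n => U (i, n) ω) (m + n)).At i n}
      · rw [indicator_of_mem h]
      · rw [indicator_of_notMem h]
        refine if_neg fun h' => h ?_
        have h'' : (run sim t J₀ c (fun i n => U (i, n) ω) (m + n + 1)).At i (n + 1) := h'
        rw [run_succ] at h''
        exact h''.of_step i.2
    rw [← add_assoc, h2, h1]
    refine le_trans (setLIntegral_mono' hset fun ω hω => ?_) (setLIntegral_le_lintegral _ _)
    exact lintegral_stayProb_step hsim hc hJ (hℓ n (by omega)) hω

/-- The while-loop at a location outside `J₀` ends almost surely. -/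
lemma ae_not_forall_at (hsim_meas : ∀ s, Measurable (fun p : ℝ × S => sim s p.1 p.2))
    (hsim : ∀ s a, 0 < a → SimulatesFinitePRM ρ (μ.restrict {f : C0 T | a ≤ f.1 s}) (sim s a))
    (hc : ∀ i, 0 < c i) (hμ : ∀ s : T, ∀ ε : ℝ, 0 < ε → μ {f : C0 T | ε < f.1 s} < ∞)
    (hJ₀ : ∀ j ∈ J₀, μ {f : C0 T | 0 < f.1 (t j)} < ∞)
    (hUm : ∀ q, Measurable (U q)) (hUl : ∀ q, HasLaw (U q) ρ Q) (hUi : iIndepFun U Q)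
    (hgood : ∀ᵐ ω ∂Q, ∀ i n, ∀ f ∈ atoms (sim (t i) (lowerLevel (c i) n) (U (i, n) ω)),
      lowerLevel (c i) n ≤ f.1 (t i))
    {i : Fin d} (hJ : i ∉ J₀) (hi : μ {f : C0 T | 0 < f.1 (t i)} = ∞) (m : ℕ) :
    ∀ᵐ ω ∂Q, ¬ ∀ n, (run sim t J₀ c (fun i n => U (i, n) ω) (m + n)).At i n := by
  have hfin : ∀ s a, 0 < a → ∀ v, FinitelyAtomic (sim s a v) :=
    fun s a ha => (hsim s a ha).finitelyAtomic
  have hanti := antitone_lowerLevel (hc i).le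
  have hR : ∀ m, Measurable (fun ω => (run sim t J₀ c (fun i n => U (i, n) ω) m).coords t) :=
    fun m => measurable_coords_run hsim_meas hfin hc (fun i n => hUm (i, n)) m
  have hlim : Tendsto (fun L => ∫⁻ ω, stayProb μ t J₀ c i (lowerLevel (c i) L) 0
      ((run sim t J₀ c (fun i n => U (i, n) ω) m).coords t) ∂Q) atTop (𝓝 0) := by
    have := tendsto_lintegral_of_dominated_convergence (μ := Q)
      (F := fun L ω => stayProb μ t J₀ c i (lowerLevel (c i) L) 0
        ((run sim t J₀ c (fun i n => U (i, n) ω) m).coords t)) (f := fun _ => 0) (fun _ => 1)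
      (fun L => (measurable_stayProb hμ i (lowerLevel_pos (hc i) L) 0).comp (hR m))
      (fun L => ae_of_all _ fun ω => ?_) (by simp) ?_
    · simpa using this
    · simp only [stayProb]
      split_ifs
      · exact expNeg_le_one _
      · exact zero_le
    · filter_upwards [hgood] with ω hω
      have hpos := posBefore_run (J₀ := J₀) hfin hc hω m
      generalize run sim t J₀ c (fun i n => U (i, n) ω) m = σ at hpos
      by_cases hat : σ.pos = i ∧ σ.iter = 0
      · have h1 : ∀ L, stayProb μ t J₀ c i (lowerLevel (c i) L) 0 (σ.coords t) =
            expNeg (μ (remaining t J₀ i (fun k => σ.path (t k)) ∩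
              {f | lowerLevel (c i) L ≤ f.1 (t i)})) := fun L => by
          refine (if_pos hat).trans ?_
          congr 3
          refine inter_eq_left.2 fun f _ => EReal.coe_lt_top _
        simp only [h1]
        refine tendsto_expNeg_top (tendsto_measure_remaining (hc i)
          (measure_remaining_eq_top hμ hJ₀ hi fun k hk hkJ => hpos k ?_ hkJ))
        rw [hat.1]; exact hk
      · have h1 : ∀ L, stayProb μ t J₀ c i (lowerLevel (c i) L) 0 (σ.coords t) = 0 :=
          fun L => if_neg hat
        simp [h1]
  have hbound : ∀ L, Q {ω | ∀ n, (run sim t J₀ c (fun i n => U (i, n) ω) (m + n)).At i n} ≤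
      ∫⁻ ω, stayProb μ t J₀ c i (lowerLevel (c i) L) 0
        ((run sim t J₀ c (fun i n => U (i, n) ω) m).coords t) ∂Q := by
    intro L
    refine le_trans ?_ (lintegral_stayProb_run hsim_meas hsim hc hμ hUm hUl hUi hJ
      (lowerLevel_pos (hc i) L) m (n := L + 1) fun l hl => hanti (by omega))
    have hset := measurableSet_at (hR (m + (L + 1))) i (L + 1)
    calc _ ≤ Q {ω | (run sim t J₀ c (fun i n => U (i, n) ω) (m + (L + 1))).At i (L + 1)} :=
          measure_mono (Set.ofPred_subset_ofPred.2 fun ω hω => hω (L + 1))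
      _ = ∫⁻ ω, indicator {ω | (run sim t J₀ c (fun i n => U (i, n) ω) (m + (L + 1))).At i (L + 1)}
            1 ω ∂Q := (lintegral_indicator_one hset).symm
      _ ≤ _ := lintegral_mono (indicator_le fun ω hω => ?_)
    -- no pass with lower level at least `ℓ` is left
    refine le_of_eq (Eq.trans ?_ (if_pos hω).symm)
    have : ({f : C0 T | lowerLevel (c i) L ≤ f.1 (t i)} ∩
        {f | (f.1 (t i) : EReal) < upperLevel (c i) (L + 1)}) = ∅ := by
      ext f
      simp [upperLevel]
    rw [this]
    simp
  rw [ae_iff]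
  simp only [not_not]
  exact le_antisymm (ge_of_tendsto' hlim hbound) zero_le

end Termination

/-! ### Joint distribution functions -/

/-- A probability measure on `ℝ^d` is determined by its joint distribution function. -/
lemma ext_of_forall_le {d : ℕ} {P₁ P₂ : Measure (Fin d → ℝ)} [IsProbabilityMeasure P₁]
    [IsProbabilityMeasure P₂]
    (h : ∀ y : Fin d → ℝ, P₁ {x | ∀ k, x k ≤ y k} = P₂ {x | ∀ k, x k ≤ y k}) : P₁ = P₂ := by
  have hspan : IsCountablySpanning (range (Iic : ℝ → Set ℝ)) :=
    ⟨fun n => Iic (n : ℝ), fun n => ⟨_, rfl⟩, eq_univ_of_forall fun x =>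
      mem_iUnion.2 (exists_nat_ge x)⟩
  have hgen : MeasurableSpace.generateFrom (range (Iic : ℝ → Set ℝ)) = Real.measurableSpace := by
    rw [← borel_eq_generateFrom_Iic]; exact (BorelSpace.measurable_eq (α := ℝ)).symm
  refine ext_of_generate_finite _ (generateFrom_eq_pi (fun _ : Fin d => hgen)
    (fun _ => hspan)).symm (IsPiSystem.pi fun _ => ?_) ?_ (by simp)
  · rintro _ ⟨a, rfl⟩ _ ⟨b, rfl⟩ -
    exact ⟨min a b, Iic_inter_Iic.symm⟩
  · rintro _ ⟨s, hs, rfl⟩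
    choose y hy using fun k => hs k (mem_univ k)
    have : univ.pi s = {x : Fin d → ℝ | ∀ k, x k ≤ y k} := by
      ext x; simp [← hy]
    rw [this]
    exact h y

section Law

variable {T : Type*} [TopologicalSpace T] {d : ℕ} {μ : Measure (C0 T)}

lemma IsExponentMeasure.measure_lt_top (hμ : IsExponentMeasure μ) (s : T) (ε : ℝ) (hε : 0 < ε) :
    μ {f : C0 T | ε < f.1 s} < ∞ := by
  have := hμ {s} isCompact_singleton ε hε
  simpa using this

lemma IsPoissonRandomMeasure.ae_measure_lt_top {E Ω : Type*} [MeasurableSpace E] [MeasurableSpace Ω]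
    {P : Measure Ω} {ν : Measure E} {N : Ω → Measure E} (hN : IsPoissonRandomMeasure P ν N)
    {A : Set E} (hA : MeasurableSet A) (hν : ν A < ∞) : ∀ᵐ ω ∂P, N ω A < ∞ := by
  have hm : MeasurableSet {x : ℝ≥0∞ | ¬ x < ∞} :=
    (measurableSet_lt measurable_id measurable_const).compl
  have h : P {ω | ¬ N ω A < ∞} = poissonLaw (ν A) {x | ¬ x < ∞} :=
    (hN.poisson A hA).measure_eq (p := fun x => ¬ x < ∞) hm
  rw [ae_iff, h, poissonLaw, if_neg hν.ne, Measure.map_apply (by fun_prop) hm]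
  convert measure_empty (μ := poissonMeasure (ν A).toNNReal)
  ext k; simp

/-- The distribution function of the maxima of a Poisson random measure. -/
lemma IsPoissonRandomMeasure.measure_maxAtoms_le {Ω : Type*} [MeasurableSpace Ω] {P : Measure Ω}
    {N : Ω → Measure (C0 T)} (hN : IsPoissonRandomMeasure P μ N)
    (hμ : ∀ s : T, ∀ ε : ℝ, 0 < ε → μ {f : C0 T | ε < f.1 s} < ∞) (t : Fin d → T)
    {y : Fin d → ℝ} (hy : ∀ k, 0 ≤ y k) :
    P {ω | ∀ k, maxAtoms (N ω) (t k) ≤ y k} = expNeg (μ (exceed t y)) := by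
  have hB := measurableSet_exceed t y
  rw [← hN.measure_eq_zero hB]
  have h1 : ∀ᵐ ω ∂P, ∀ k, N ω {f | 1 < f.1 (t k)} < ∞ :=
    ae_all_iff.2 fun k => hN.ae_measure_lt_top
      (measurableSet_lt measurable_const (measurable_eval _)) (hμ _ 1 one_pos)
  refine measure_congr ?_
  filter_upwards [hN.pointMeasure, h1] with ω hω hfin
  refine propext ?_
  change (∀ k, maxAtoms (N ω) (t k) ≤ y k) ↔ N ω (exceed t y) = 0
  rw [hω.measure_eq_zero_iff hB]
  -- only finitely many atoms exceed height `1`, so the supremum is not a junk value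
  have hbdd : ∀ k, BddAbove (range fun f : atoms (N ω) => f.1.1 (t k)) := fun k => by
    obtain ⟨b, hb⟩ := ((finite_atoms_inter (hfin k)).image fun f => f.1 (t k)).bddAbove
    refine ⟨max b 1, ?_⟩
    rintro _ ⟨f, rfl⟩
    rcases lt_or_ge 1 (f.1.1 (t k)) with hf | hf
    · exact le_max_of_le_left (hb ⟨f.1, ⟨f.2, hf⟩, rfl⟩)
    · exact le_max_of_le_right hf
  constructor
  · rintro h f hf ⟨k, hk⟩
    exact absurd ((le_ciSup (hbdd k) ⟨f, hf⟩).trans (h k)) (not_le.2 hk)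
  · intro h k
    refine Real.iSup_le (fun f => ?_) (hy k)
    by_contra! hc
    exact h f.1 f.2 ⟨k, hc⟩

/-- The exponent measure is σ-finite on `exceed t y`, although it need not be so on all of `C₀(T)`
for non-separable `T`. -/
lemma sfinite_restrict_exceed (hμ : ∀ s : T, ∀ ε : ℝ, 0 < ε → μ {f : C0 T | ε < f.1 s} < ∞)
    (t : Fin d → T) {y : Fin d → ℝ} (hy : ∀ k, 0 ≤ y k) : SFinite (μ.restrict (exceed t y)) := by
  have hB := measurableSet_exceed t y
  have : SigmaFinite (μ.restrict (exceed t y)) := by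
    refine ⟨⟨⟨fun n => (exceed t y)ᶜ ∪ exceed t fun _ => 1 / ((n : ℝ) + 1), fun _ => trivial,
      fun n => ?_, ?_⟩⟩⟩
    · rw [Measure.restrict_apply' hB, union_inter_distrib_right, compl_inter_self, empty_union]
      refine (measure_mono inter_subset_left).trans_lt ?_
      have : exceed t (fun _ => 1 / ((n : ℝ) + 1)) =
          ⋃ k, {f : C0 T | 1 / ((n : ℝ) + 1) < f.1 (t k)} := by
        ext f; simp [exceed]
      rw [this]
      refine (measure_iUnion_le _).trans_lt ?_
      rw [tsum_fintype]
      exact ENNReal.sum_lt_top.2 fun k _ => hμ (t k) _ Nat.one_div_pos_of_nat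
    · refine eq_univ_of_forall fun f => mem_iUnion.2 ?_
      by_cases hf : f ∈ exceed t y
      · obtain ⟨k, hk⟩ := hf
        obtain ⟨n, hn⟩ := exists_nat_one_div_lt ((hy k).trans_lt hk)
        exact ⟨n, Or.inr ⟨k, hn⟩⟩
      · exact ⟨0, Or.inl hf⟩
  infer_instance

lemma measurableSet_muPart_set (t : Fin d → T) (J₀ : Set (Fin d)) (j : Fin d) :
    MeasurableSet {f : C0 T | 0 < f.1 (t j) ∧ ∀ k < j, k ∈ J₀ → f.1 (t k) = 0} :=
  (measurableSet_lt measurable_const (measurable_eval _)).inter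
    (measurableSet_setOfPred.2 (Measurable.forall fun k => Measurable.imp measurable_const
      (Measurable.imp measurable_const (measurableSet_setOfPred.1
        (measurableSet_eq_fun (measurable_eval (t k)) measurable_const)))))

open Classical in
/-- Every function either vanishes on `J₀` or is sorted into `μ_j` by the first location `j` in
`J₀` at which it is positive. -/
lemma measure_eq_sum_muPart_add (t : Fin d → T) (J₀ : Set (Fin d)) {B : Set (C0 T)}
    (hB : MeasurableSet B) :
    μ B = ∑ j ∈ J₀.toFinset, muPart μ t J₀ j B + μ (residualSet t J₀ ∩ B) := by
  let D : Fin d → Set (C0 T) := fun j =>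
    B ∩ {f : C0 T | 0 < f.1 (t j) ∧ ∀ k < j, k ∈ J₀ → f.1 (t k) = 0}
  have hD : ∀ j, MeasurableSet (D j) := fun j => hB.inter (measurableSet_muPart_set t J₀ j)
  have hd : PairwiseDisjoint (↑J₀.toFinset : Set (Fin d)) D := by
    have aux : ∀ i ∈ J₀, ∀ j, i < j → Disjoint (D i) (D j) := fun i hi j hij =>
      Set.disjoint_left.2 fun f hf hf' => hf.2.1.ne' (hf'.2.2 i hij hi)
    intro i hi j hj hij
    rw [Set.coe_toFinset] at hi hj
    rcases lt_or_gt_of_ne hij with h | h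
    · exact aux i hi j h
    · exact (aux j hj i h).symm
  have hU : MeasurableSet (⋃ j ∈ J₀.toFinset, D j) :=
    Finset.measurableSet_biUnion _ fun j _ => hD j
  have hsum : ∑ j ∈ J₀.toFinset, muPart μ t J₀ j B = μ (⋃ j ∈ J₀.toFinset, D j) := by
    rw [measure_biUnion_finset hd fun j _ => hD j]
    exact Finset.sum_congr rfl fun j _ => Measure.restrict_apply hB
  rw [hsum, ← measure_inter_add_sdiff B hU]
  congr 2
  · exact inter_eq_right.2 (iUnion₂_subset fun j _ => inter_subset_left)
  · ext f
    constructor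
    · rintro ⟨hfB, hf⟩
      refine ⟨fun j hj => ?_, hfB⟩
      -- strong induction: the first positive location in `J₀` would put `f` into `D j`
      induction j using WellFoundedLT.induction with
      | ind j ih =>
        by_contra h0
        exact hf (mem_iUnion₂.2 ⟨j, by simpa using hj, hfB,
          lt_of_le_of_ne (f.2.1 _) (Ne.symm h0), fun k hk hkJ => ih k hk hkJ⟩)
    · rintro ⟨hf, hfB⟩
      refine ⟨hfB, fun h => ?_⟩
      obtain ⟨j, hj, hfj⟩ := mem_iUnion₂.1 h
      exact hfj.2.1.ne' (hf j (by simpa using hj))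

lemma expNeg_sum {ι : Type*} (s : Finset ι) (a : ι → ℝ≥0∞) :
    expNeg (∑ i ∈ s, a i) = ∏ i ∈ s, expNeg (a i) := by
  classical
  induction s using Finset.induction_on with
  | empty => simp
  | insert i s hi ih => rw [Finset.sum_insert hi, Finset.prod_insert hi, expNeg_add, ih]

end Law

/-! ### The output -/

section Output

variable {T : Type*} [TopologicalSpace T] {d : ℕ} {S : Type*}
  {sim : T → ℝ → S → Measure (C0 T)} {simJ : Fin d → S → Measure (C0 T)} {t : Fin d → T}
  {J₀ : Set (Fin d)} {c : Fin d → ℝ} {μ : Measure (C0 T)}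

/-- After termination the run is constant. -/
lemma exists_run_eq_final {u : Fin d → ℕ → S} (h : Terminates sim t J₀ c u) :
    ∃ M, ∀ m ≥ M, (run sim t J₀ c u m).pos = d ∧
      (run sim t J₀ c u m).path = finalPath sim t J₀ c u := by
  classical
  refine ⟨Nat.find h, fun m hm => ?_⟩
  have hconst : run sim t J₀ c u m = run sim t J₀ c u (Nat.find h) := by
    induction m, hm using Nat.le_induction with
    | base => rfl
    | succ m _ ih =>
      rw [run_succ, ih, step_of_not_lt]
      rw [Nat.find_spec h]
      exact lt_irrefl d
  rw [hconst]
  refine ⟨Nat.find_spec h, ?_⟩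
  rw [finalPath, dif_pos h]

lemma finalPath_nonneg (u : Fin d → ℕ → S) (s : T) : 0 ≤ finalPath sim t J₀ c u s := by
  by_cases h : Terminates sim t J₀ c u
  · obtain ⟨M, hM⟩ := exists_run_eq_final h
    rw [← (hM M le_rfl).2]
    exact path_run_nonneg _ _ _
  · simp [finalPath, h]

lemma tendsto_path_run {u : Fin d → ℕ → S} (h : Terminates sim t J₀ c u) (s : T) :
    Tendsto (fun m => (run sim t J₀ c u m).path s) atTop (𝓝 (finalPath sim t J₀ c u s)) := by
  obtain ⟨M, hM⟩ := exists_run_eq_final h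
  refine tendsto_const_nhds.congr' ?_
  filter_upwards [eventually_ge_atTop M] with m hm
  rw [(hM m hm).2]

/-- At the end of the main loop no function that is still possible could change the path. -/
lemma potential_final {y : Fin d → ℝ} (hy : ∀ k, 0 ≤ y k) {n : ℕ} {x : Fin d → ℝ}
    (hx : ∀ k, x k ≤ y k) : potential μ t J₀ c y (d, n, x) = 1 := by
  rw [potential_of_le hx]
  have : remaining t J₀ d x ∩ window t J₀ c d n x ∩ exceed t y = ∅ := by
    ext f
    refine iff_of_false ?_ (notMem_empty f)
    rintro ⟨⟨⟨h1, h2⟩, -⟩, k, hk⟩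
    by_cases hkJ : k ∈ J₀
    · rw [h1 k hkJ] at hk
      exact absurd hk (not_lt.2 (hy k))
    · exact absurd ((h2 k k.2 hkJ).trans_le (hx k)) (not_lt.2 hk.le)
  simp [this]

lemma output_le_iff (hJ : ∀ j ∈ J₀, ∀ v, FinitelyAtomic (simJ j v)) {y : Fin d → ℝ}
    (hy : ∀ k, 0 ≤ y k) (u : Fin d → ℕ → S) :
    (∀ k, output sim simJ t J₀ c u (t k) ≤ y k) ↔
      (∀ j ∈ J₀, simJ j (u j 0) (exceed t y) = 0) ∧
        ∀ k, finalPath sim t J₀ c u (t k) ≤ y k := by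
  have h1 : ∀ k, (⨆ j : J₀, maxAtoms (simJ j (u j 0)) (t k)) ≤ y k ↔
      ∀ j ∈ J₀, maxAtoms (simJ j (u j 0)) (t k) ≤ y k := fun k =>
    ⟨fun h j hj => (le_ciSup (f := fun j : J₀ => maxAtoms (simJ j (u j 0)) (t k))
      (finite_range _).bddAbove ⟨j, hj⟩).trans h, fun h => Real.iSup_le (fun j => h j j.2) (hy k)⟩
  have h2 : ∀ j ∈ J₀, (simJ j (u j 0) (exceed t y) = 0 ↔
      ∀ k, maxAtoms (simJ j (u j 0)) (t k) ≤ y k) := fun j hj => by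
    rw [(hJ j hj _).null_iff (measurableSet_exceed t y)]
    simp only [(hJ j hj _).maxAtoms_le_iff (hy _), exceed, mem_ofPred_eq, not_exists, not_lt]
    exact ⟨fun h k f hf => h f hf k, fun h f hf k => h k f hf⟩
  simp only [output, max_le_iff, h1]
  constructor
  · exact fun h => ⟨fun j hj => (h2 j hj).2 fun k => (h k).1 j hj, fun k => (h k).2⟩
  · exact fun h k => ⟨fun j hj => (h2 j hj).1 (h.1 j hj) k, h.2 k⟩

variable [MeasurableSpace S] {ρ : Measure S} [IsProbabilityMeasure ρ]
  {Ω₀ : Type*} [MeasurableSpace Ω₀] {Q : Measure Ω₀} [IsProbabilityMeasure Q]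
  {U : Fin d × ℕ → Ω₀ → S}

theorem ae_terminates (hsim_meas : ∀ s, Measurable (fun p : ℝ × S => sim s p.1 p.2))
    (hsim : ∀ s a, 0 < a → SimulatesFinitePRM ρ (μ.restrict {f : C0 T | a ≤ f.1 s}) (sim s a))
    (hc : ∀ i, 0 < c i) (hμ : ∀ s : T, ∀ ε : ℝ, 0 < ε → μ {f : C0 T | ε < f.1 s} < ∞)
    (hJ₀ : ∀ j, j ∈ J₀ ↔ μ {f : C0 T | 0 < f.1 (t j)} < ∞)
    (hUm : ∀ q, Measurable (U q)) (hUl : ∀ q, HasLaw (U q) ρ Q) (hUi : iIndepFun U Q) :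
    ∀ᵐ ω ∂Q, Terminates sim t J₀ c (fun i n => U (i, n) ω) := by
  have hgood : ∀ᵐ ω ∂Q, ∀ i n, ∀ f ∈ atoms (sim (t i) (lowerLevel (c i) n) (U (i, n) ω)),
      lowerLevel (c i) n ≤ f.1 (t i) := by
    refine ae_all_iff.2 fun i => ae_all_iff.2 fun n => ?_
    have h := (hsim (t i) _ (lowerLevel_pos (hc i) n)).ae_forall_atoms_ge (s := t i)
      (c := lowerLevel (c i) n) (restrict_ge_apply_lt _ _ _)
    rw [← (hUl (i, n)).map_eq] at h
    exact ae_of_ae_map (hUm _).aemeasurable h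
  have hstay : ∀ᵐ ω ∂Q, ∀ i : Fin d, i ∉ J₀ → ∀ m,
      ¬ ∀ n, (run sim t J₀ c (fun i n => U (i, n) ω) (m + n)).At i n := by
    refine ae_all_iff.2 fun i => ?_
    by_cases hJ : i ∈ J₀
    · exact ae_of_all _ fun ω h => absurd hJ h
    · have hi : μ {f : C0 T | 0 < f.1 (t i)} = ∞ := by
        rwa [hJ₀ i, lt_top_iff_ne_top, not_not] at hJ
      have := ae_all_iff.2 fun m => ae_not_forall_at hsim_meas hsim hc hμ
        (fun j hj => (hJ₀ j).1 hj) hUm hUl hUi hgood hJ hi m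
      filter_upwards [this] with ω hω _ using hω
  filter_upwards [hstay] with ω hω using terminates_of_forall hω

omit [IsProbabilityMeasure Q] in
lemma aemeasurable_finalPath (hsim_meas : ∀ s, Measurable (fun p : ℝ × S => sim s p.1 p.2))
    (hfin : ∀ s a, 0 < a → ∀ v, FinitelyAtomic (sim s a v)) (hc : ∀ i, 0 < c i)
    (hUm : ∀ q, Measurable (U q))
    (hterm : ∀ᵐ ω ∂Q, Terminates sim t J₀ c (fun i n => U (i, n) ω)) (k : Fin d) :
    AEMeasurable (fun ω => finalPath sim t J₀ c (fun i n => U (i, n) ω) (t k)) Q := by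
  refine aemeasurable_of_tendsto_metrizable_ae atTop
    (f := fun m ω => (run sim t J₀ c (fun i n => U (i, n) ω) m).path (t k)) (fun m => ?_) ?_
  · have hR : Measurable (fun ω => (run sim t J₀ c (fun i n => U (i, n) ω) m).coords t) :=
      measurable_coords_run hsim_meas hfin hc (fun i n => hUm (i, n)) m
    exact ((measurable_pi_apply k).comp hR.snd.snd).aemeasurable
  · filter_upwards [hterm] with ω hω using tendsto_path_run hω (t k)

open Classical in
/-- The distribution function of the output: the potential at the start of the main loop and the
contributions of the locations in `J₀` multiply to the value for the exponent measure. -/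
theorem measure_output_le (hsim_meas : ∀ s, Measurable (fun p : ℝ × S => sim s p.1 p.2))
    (hsim : ∀ s a, 0 < a → SimulatesFinitePRM ρ (μ.restrict {f : C0 T | a ≤ f.1 s}) (sim s a))
    (hsimJ : ∀ j ∈ J₀, SimulatesFinitePRM ρ (muPart μ t J₀ j) (simJ j))
    (hc : ∀ i, 0 < c i) (hμ : ∀ s : T, ∀ ε : ℝ, 0 < ε → μ {f : C0 T | ε < f.1 s} < ∞)
    (hUm : ∀ q, Measurable (U q)) (hUl : ∀ q, HasLaw (U q) ρ Q) (hUi : iIndepFun U Q)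
    (hterm : ∀ᵐ ω ∂Q, Terminates sim t J₀ c (fun i n => U (i, n) ω))
    {y : Fin d → ℝ} (hy : ∀ k, 0 ≤ y k) :
    Q {ω | ∀ k, output sim simJ t J₀ c (fun i n => U (i, n) ω) (t k) ≤ y k} =
      expNeg (μ (exceed t y)) := by
  have hB := measurableSet_exceed t y
  have hfin : ∀ s a, 0 < a → ∀ v, FinitelyAtomic (sim s a v) :=
    fun s a ha => (hsim s a ha).finitelyAtomic
  have := sfinite_restrict_exceed hμ t hy
  have hpre : ∀ j ∈ J₀, MeasurableSet {v | simJ j v (exceed t y) = 0} := fun j hj =>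
    ((Measure.measurable_coe hB).comp (hsimJ j hj).1.measurable) (measurableSet_singleton 0)
  -- `A` is the event that the maxima for the locations in `J₀` stay below `y`
  let A : Set (Fin d × ℕ → S) := {v | ∀ j ∈ J₀, simJ j (v (j, 0)) (exceed t y) = 0}
  have hA : MeasurableSet A := by
    have : A = ⋂ j ∈ J₀, {v | simJ j (v (j, 0)) (exceed t y) = 0} := by ext; simp [A]
    rw [this]
    exact MeasurableSet.biInter (to_countable J₀) fun j hj =>
      measurable_pi_apply (X := fun _ : Fin d × ℕ => S) (j, 0) (hpre j hj)
  have hV : Measurable (fun ω => fun q => U q ω) := measurable_pi_lambda _ hUm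
  let W : (Fin d × ℕ → S) → ℝ≥0∞ := indicator A 1
  have hW1 : ∀ v ∈ A, W v = 1 := fun v hv => indicator_of_mem hv 1
  have hW0 : ∀ v ∉ A, W v = 0 := fun v hv => indicator_of_notMem hv 1
  have hWm : Measurable W := measurable_one.indicator hA
  have hWp : ∀ v v' : Fin d × ℕ → S, (∀ q : Fin d × ℕ, q.1 ∈ J₀ → v q = v' q) → W v = W v' := by
    intro v v' hv
    have h : v ∈ A ↔ v' ∈ A := forall₂_congr fun j hj => by rw [hv (j, 0) hj]
    by_cases hvA : v ∈ A
    · rw [hW1 v hvA, hW1 v' (h.1 hvA)]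
    · rw [hW0 v hvA, hW0 v' fun h' => hvA (h.2 h')]
  have hmart := lintegral_potential_run (t := t) (c := c) hsim_meas hsim hc hUm hUl hUi hWm hWp hy
  have hW : ∫⁻ ω, W (fun q => U q ω) ∂Q =
      ∏ j ∈ J₀.toFinset, expNeg (muPart μ t J₀ j (exceed t y)) := by
    have h1 : ∫⁻ ω, W (fun q => U q ω) ∂Q = Q ((fun ω => fun q => U q ω) ⁻¹' A) :=
      lintegral_indicator_one (hV hA)
    have h2 : (fun ω => fun q => U q ω) ⁻¹' A =
        ⋂ j ∈ J₀.toFinset, U (j, 0) ⁻¹' {v | simJ j v (exceed t y) = 0} := by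
      ext ω; simp [A]
    have hind := hUi.precomp (g := fun j : Fin d => (j, 0)) (Prod.mk_left_injective 0)
    rw [h1, h2, hind.measure_inter_preimage_eq_mul _ fun j hj => hpre j (by simpa using hj)]
    refine Finset.prod_congr rfl fun j hj => ?_
    rw [Set.mem_toFinset] at hj
    rw [← (hsimJ j hj).1.measure_eq_zero hB]
    exact (hUl (j, 0)).measure_eq (hpre j hj)
  have hinit : potential μ t J₀ c y (0, 0, 0) = expNeg (μ (residualSet t J₀ ∩ exceed t y)) := by
    rw [potential_of_le (x := 0) hy, window_zero, inter_univ]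
    congr 3
    ext f
    exact ⟨fun h => h.1, fun h => ⟨h, fun k hk => absurd hk (Nat.not_lt_zero _)⟩⟩
  have hR : ∀ m, Measurable (fun ω => (run sim t J₀ c (fun i n => U (i, n) ω) m).coords t) :=
    fun m => measurable_coords_run hsim_meas hfin hc (fun i n => hUm (i, n)) m
  let F : Set Ω₀ := {ω | ∀ k, finalPath sim t J₀ c (fun i n => U (i, n) ω) (t k) ≤ y k}
  have hFnull : NullMeasurableSet F Q := by
    have : F = ⋂ k, {ω | finalPath sim t J₀ c (fun i n => U (i, n) ω) (t k) ≤ y k} := by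
      ext; simp [F]
    rw [this]
    exact NullMeasurableSet.iInter fun k => nullMeasurableSet_le
      (aemeasurable_finalPath hsim_meas hfin hc hUm hterm k) aemeasurable_const
  have hlim := tendsto_lintegral_of_dominated_convergence (μ := Q)
    (F := fun m ω => W (fun q => U q ω) *
      potential μ t J₀ c y ((run sim t J₀ c (fun i n => U (i, n) ω) m).coords t))
    (f := fun ω => indicator ((fun ω => fun q => U q ω) ⁻¹' A ∩ F) 1 ω) (fun _ => 1)
    (fun m => (hWm.comp hV).mul ((measurable_potential y).comp (hR m)))
    (fun m => ae_of_all _ fun ω => ?_) (by simp) ?_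
  · simp_rw [hmart, hW, hinit] at hlim
    rw [← expNeg_sum, ← expNeg_add, ← measure_eq_sum_muPart_add t J₀ hB] at hlim
    have h3 := tendsto_nhds_unique hlim tendsto_const_nhds
    rw [← h3, lintegral_indicator_one₀ ((hV hA).nullMeasurableSet.inter hFnull)]
    congr 1
    ext ω
    exact output_le_iff (fun j hj => (hsimJ j hj).finitelyAtomic) hy _
  · exact mul_le_one' (indicator_le (fun _ _ => le_rfl) _) (potential_le_one y _)
  · filter_upwards [hterm] with ω hω
    obtain ⟨M, hM⟩ := exists_run_eq_final hω
    refine tendsto_const_nhds.congr' ?_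
    filter_upwards [eventually_ge_atTop M] with m hm
    have h1 := hM m hm
    have hcoords : (run sim t J₀ c (fun i n => U (i, n) ω) m).coords t =
        (d, (run sim t J₀ c (fun i n => U (i, n) ω) m).iter,
          fun k => finalPath sim t J₀ c (fun i n => U (i, n) ω) (t k)) := by
      rw [State.coords, h1.1, h1.2]
    rw [hcoords]
    by_cases hF : ω ∈ F
    · rw [potential_final hy hF, mul_one]
      by_cases h : ω ∈ (fun ω => fun q => U q ω) ⁻¹' A
      · rw [indicator_of_mem (by exact ⟨h, hF⟩), hW1 _ h]; rfl
      · rw [indicator_of_notMem (fun h' => h h'.1), hW0 _ h]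
    · rw [potential_of_not_le hF, mul_zero, indicator_of_notMem (fun h' => hF h'.2)]

end Output

end MaxId

theorem mainTheorem1
    {T : Type*} [MetricSpace T] [LocallyCompactSpace T]
    -- a continuous, non-negative max-id process with vertex `0`
    {Ω : Type*} [MeasurableSpace Ω] (P : Measure Ω) [IsProbabilityMeasure P]
    (X : T → Ω → ℝ)
    (hX_meas : ∀ s, Measurable (X s))
    (hX_cont : ∀ ω, Continuous (fun s => X s ω))
    (hX_nonneg : ∀ s ω, 0 ≤ X s ω)
    (hX_maxid : MaxId.IsMaxId P X)
    (hX_vertex : ∀ s, MaxId.vertex P X s = 0)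
    -- `μ` is its exponent measure: `X` has the law of the maximum of the atoms of a Poisson random
    -- measure with intensity `μ`
    (μ : Measure (MaxId.C0 T)) (hμ : MaxId.IsExponentMeasure μ)
    {Ω' : Type*} [MeasurableSpace Ω'] (P' : Measure Ω') [IsProbabilityMeasure P']
    (N : Ω' → Measure (MaxId.C0 T)) (hN : MaxId.IsPoissonRandomMeasure P' μ N)
    (hXN : IdentDistrib (fun ω s => X s ω) (fun ω s => MaxId.maxAtoms (N ω) s) P P')
    -- the chosen locations
    {d : ℕ} (t : Fin d → T)
    -- the simulation procedures for the finite Poisson random measures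
    {S : Type*} [MeasurableSpace S] (ρ : Measure S) [IsProbabilityMeasure ρ]
    (sim : T → ℝ → S → Measure (MaxId.C0 T))
    (hsim_meas : ∀ s, Measurable (fun p : ℝ × S => sim s p.1 p.2))
    (hsim : ∀ (s : T) (c : ℝ), 0 < c →
      MaxId.SimulatesFinitePRM ρ (μ.restrict {f : MaxId.C0 T | c ≤ f.1 s}) (sim s c))
    (simJ : Fin d → S → Measure (MaxId.C0 T))
    (hsimJ : ∀ j ∈ MaxId.zeroLocations P X t,
      IsFiniteMeasure (MaxId.muPart μ t (MaxId.zeroLocations P X t) j) →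
      MaxId.SimulatesFinitePRM ρ (MaxId.muPart μ t (MaxId.zeroLocations P X t) j) (simJ j))
    -- the initial levels of the while-loops
    (c : Fin d → ℝ) (hc : ∀ i, 0 < c i)
    -- fresh independent seeds for all calls of the simulation procedures
    {Ω₀ : Type*} [MeasurableSpace Ω₀] (Q : Measure Ω₀) [IsProbabilityMeasure Q]
    (U : Fin d → ℕ → Ω₀ → S)
    (hU_meas : ∀ i n, Measurable (U i n))
    (hU_law : ∀ i n, HasLaw (U i n) ρ Q)
    (hU_indep : iIndepFun (fun p : Fin d × ℕ => U p.1 p.2) Q) :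
    -- the measures `μ_j` are finite, the algorithm stops almost surely, and its output is exact
    (∀ j ∈ MaxId.zeroLocations P X t,
      IsFiniteMeasure (MaxId.muPart μ t (MaxId.zeroLocations P X t) j)) ∧
    (∀ᵐ ω ∂Q, MaxId.Terminates sim t (MaxId.zeroLocations P X t) c (fun i n => U i n ω)) ∧
    IdentDistrib
      (fun ω i => MaxId.output sim simJ t (MaxId.zeroLocations P X t) c (fun i n => U i n ω) (t i))
      (fun ω i => X (t i) ω) Q P := by
  classical
  set J₀ := MaxId.zeroLocations P X t
  have hμ' := hμ.measure_lt_top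
  have hXle : ∀ {e : ℕ} (r : Fin e → T) {y : Fin e → ℝ}, (∀ k, 0 ≤ y k) →
      P {ω | ∀ k, X (r k) ω ≤ y k} = MaxId.expNeg (μ (MaxId.exceed r y)) := by
    intro e r y hy
    have hm : MeasurableSet {g : T → ℝ | ∀ k, g (r k) ≤ y k} :=
      measurableSet_setOfPred.2 (Measurable.forall fun k => measurableSet_setOfPred.1
        (measurableSet_le (measurable_pi_apply (r k)) measurable_const))
    rw [← hN.measure_maxAtoms_le hμ' r hy]
    exact hXN.measure_mem_eq hm
  have hJ₀ : ∀ j, j ∈ J₀ ↔ μ {f : MaxId.C0 T | 0 < f.1 (t j)} < ∞ := by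
    intro j
    have h := hXle (fun _ : Fin 1 => t j) (y := fun _ => 0) fun _ => le_rfl
    have h1 : {ω | ∀ k : Fin 1, X ((fun _ => t j) k) ω ≤ 0} = {ω | X (t j) ω = 0} := by
      ext ω
      exact ⟨fun h => le_antisymm (h 0) (hX_nonneg _ ω), fun h _ => h.le⟩
    have h2 : MaxId.exceed (fun _ : Fin 1 => t j) (fun _ => 0) =
        {f : MaxId.C0 T | 0 < f.1 (t j)} := by
      ext f; simp [MaxId.exceed]
    rw [h1, h2] at h
    change 0 < P {ω | X (t j) ω = 0} ↔ _
    rw [h, MaxId.expNeg_pos_iff, lt_top_iff_ne_top]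
  have hfinite : ∀ j ∈ J₀, IsFiniteMeasure (MaxId.muPart μ t J₀ j) := fun j hj =>
    ⟨by
      rw [MaxId.muPart, Measure.restrict_apply_univ]
      exact (measure_mono fun f hf => hf.1).trans_lt ((hJ₀ j).1 hj)⟩
  have hsimJ' := fun j hj => hsimJ j hj (hfinite j hj)
  have hfin : ∀ s a, 0 < a → ∀ v, MaxId.FinitelyAtomic (sim s a v) :=
    fun s a ha => (hsim s a ha).finitelyAtomic
  have hUm : ∀ q : Fin d × ℕ, Measurable (U q.1 q.2) := fun q => hU_meas _ _
  have hterm : ∀ᵐ ω ∂Q, MaxId.Terminates sim t J₀ c (fun i n => U i n ω) :=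
    MaxId.ae_terminates (U := fun q : Fin d × ℕ => U q.1 q.2) hsim_meas hsim hc hμ' hJ₀ hUm
      (fun q => hU_law _ _) hU_indep
  refine ⟨hfinite, hterm, ?_⟩
  have hout : AEMeasurable
      (fun ω i => MaxId.output sim simJ t J₀ c (fun i n => U i n ω) (t i)) Q := by
    refine aemeasurable_pi_lambda _ fun i => AEMeasurable.max ?_ ?_
    · exact (Measurable.iSup fun j : J₀ => (MaxId.measurable_maxAtoms (hsimJ' j j.2).1.measurable
        (hsimJ' j j.2).finitelyAtomic (t i)).comp (hU_meas j 0)).aemeasurable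
    · exact MaxId.aemeasurable_finalPath (U := fun q : Fin d × ℕ => U q.1 q.2) hsim_meas hfin hc
        hUm hterm i
  have hXm : Measurable (fun ω i => X (t i) ω) := measurable_pi_lambda _ fun i => hX_meas _
  refine ⟨hout, hXm.aemeasurable, ?_⟩
  have := Measure.isProbabilityMeasure_map hout
  have := Measure.isProbabilityMeasure_map (μ := P) hXm.aemeasurable
  refine MaxId.ext_of_forall_le fun y => ?_
  have hm : MeasurableSet {x : Fin d → ℝ | ∀ k, x k ≤ y k} :=
    measurableSet_setOfPred.2 (Measurable.forall fun k => measurableSet_setOfPred.1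
      (measurableSet_le (measurable_pi_apply k) measurable_const))
  rw [Measure.map_apply_of_aemeasurable hout hm, Measure.map_apply hXm hm]
  by_cases hy : ∀ k, 0 ≤ y k
  · exact (MaxId.measure_output_le (U := fun q : Fin d × ℕ => U q.1 q.2) hsim_meas hsim hsimJ'
      hc hμ' hUm (fun q => hU_law _ _) hU_indep hterm hy).trans (hXle t hy).symm
  · -- both sides are non-negative, so a negative bound is never met
    push Not at hy
    obtain ⟨k, hk⟩ := hy
    have h1 : (fun ω i => MaxId.output sim simJ t J₀ c (fun i n => U i n ω) (t i)) ⁻¹'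
        {x : Fin d → ℝ | ∀ k, x k ≤ y k} = ∅ := Set.eq_empty_of_forall_notMem fun ω h =>
      absurd (((MaxId.finalPath_nonneg _ _).trans (le_max_right _ _)).trans (h k)) (not_le.2 hk)
    have h2 : (fun ω i => X (t i) ω) ⁻¹' {x : Fin d → ℝ | ∀ k, x k ≤ y k} = ∅ :=
      Set.eq_empty_of_forall_notMem fun ω h =>
        absurd ((hX_nonneg (t k) ω).trans (h k)) (not_le.2 hk)
    rw [h1, h2, measure_empty, measure_empty]
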